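/- Let $\mathbb F$ be a field. A Lie triple system over $\mathbb F$ is an $\mathbb F$-vector space $\mathcal T$ with a trilinear map $[\cdot,\cdot,\cdot]:\mathcal T^3\to\mathcal T$ such that, for all $x,y,z,u,v\in\mathcal T$, $$[x,y,z]+[y,x,z]=0,\qquad [x,y,z]+[y,z,x]+[z,x,y]=0,$$ $$[u,v,[x,y,z]]=[[u,v,x],y,z]+[x,[u,v,y],z]+[x,y,[u,v,z]].$$ An isomorphism is a linear bijection preserving the bracket. $\mathcal T$ is nilpotent if $\mathcal T^{(m)}=0$ for some $m\ge 0$, where $\mathcal T^{(0)}=\mathcal T$ and $\mathcal T^{(n+1)}=[\mathcal T^{(n)},\mathcal T,\mathcal T]+[\mathcal T,\mathcal T,\mathcal T^{(n)}]$ (linear spans of products). Suppose now that $\mathbb F$ is algebraically closed of characteristic different from $2$ and $3$. Consider the following triple systems on $\mathbb F^4$ with basis $e_1,e_2,e_3,e_4$, where all products of basis vectors are zero except the listed ones and those obtained from them by $[x,y,z]=-[y,x,z]$: - $\mathcal T_{4,1}$: all products zero (abelian). - $\mathcal T_{4,2}$: $[e_1,e_2,e_1]=e_3$. - $\mathcal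 T_{4,3}$: $[e_1,e_2,e_1]=e_3$, $[e_1,e_2,e_2]=e_4$. - $\mathcal T_{4,4}$: $[e_2,e_3,e_2]=e_4$, $[e_3,e_1,e_3]=e_4$. - $\mathcal T_{4,5}$: $[e_2,e_3,e_1]=e_4$, $[e_3,e_1,e_2]=e_4$, $[e_2,e_1,e_3]=2e_4$, $[e_2,e_3,e_2]=e_4$. - $\mathcal T_{4,6}^{\lambda}$ ($\lambda\in\mathbb F$): $[e_1,e_2,e_3]=-(\lambda+1)e_4$, $[e_2,e_3,e_1]=\lambda e_4$, $[e_3,e_1,e_2]=e_4$. - $\mathcal T_{4,7}$: $[e_1,e_2,e_1]=e_3$, $[e_1,e_2,e_3]=e_4$, $[e_1,e_3,e_2]=e_4$. - $\mathcal T_{4,8}$: $[e_1,e_2,e_1]=e_3$, $[e_1,e_3,e_1]=e_4$, $[e_1,e_2,e_2]=e_4$. - $\mathcal T_{4,9}$: $[e_1,e_2,e_1]=e_3$, $[e_1,e_3,e_1]=e_4$. All of these are nilpotent Lie triple systems, and every $4$-dimensional nilpotent Lie triple system over $\mathbb F$ is isomorphic to one of them. The only isomorphisms between distinct members of this list are the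 following: $\mathcal T_{4,6}^{0}\cong\mathcal T_{4,6}^{-1}$; and, for $\alpha,\beta\in\mathbb F$ with $\alpha^2+\alpha\ne0$ and $\beta^2+\beta\neq 0$, $\mathcal T_{4,6}^{\alpha}\cong\mathcal T_{4,6}^{\beta}$ if and only if $\xi(\alpha)=\xi(\beta)$, where $$\xi(\lambda)=\frac{(\lambda^2+\lambda+1)^3}{\lambda^2(\lambda+1)^2}.$$ -/

import Mathlib

/-- A Lie triple system structure on the vector space `T`: a trilinear bracket `[x, y, z]` that is
skew-symmetric in the first two arguments, satisfies the ternary Jacobi identity, and for which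
every `[u, v, ·]` is a derivation. -/
structure LieTripleSystem (F T : Type*) [Field F] [AddCommGroup T] [Module F T] where
  bracket : T →ₗ[F] T →ₗ[F] T →ₗ[F] T
  skew : ∀ x y z, bracket x y z + bracket y x z = 0
  cyclic : ∀ x y z, bracket x y z + bracket y z x + bracket z x y = 0
  derivation : ∀ u v x y z, bracket u v (bracket x y z) =
    bracket (bracket u v x) y z + bracket x (bracket u v y) z + bracket x y (bracket u v z)

namespace LieTripleSystem

section General

variable {F T T' : Type*} [Field F] [AddCommGroup T] [Module F T] [AddCommGroup T'] [Module F T']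

/-- `[A, B, C]`: the linear span of all products `[a, b, c]` with `a ∈ A`, `b ∈ B`, `c ∈ C`. -/
def bracketSpan (S : LieTripleSystem F T) (A B C : Submodule F T) : Submodule F T :=
  Submodule.span F {w | ∃ a ∈ A, ∃ b ∈ B, ∃ c ∈ C, S.bracket a b c = w}

/-- The sequence `I⁽⁰⁾ = I`, `I⁽ⁿ⁺¹⁾ = [I⁽ⁿ⁾, T, I] + [I, T, I⁽ⁿ⁾]`. -/
def series (S : LieTripleSystem F T) (I : Submodule F T) : ℕ → Submodule F T
  | 0 => I
  | n + 1 => S.bracketSpan (S.series I n) ⊤ I ⊔ S.bracketSpan I ⊤ (S.series I n)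

/-- A Lie triple system `T` is nilpotent if `T⁽ᵐ⁾ = 0` for some `m`. -/
def IsNilpotent (S : LieTripleSystem F T) : Prop :=
  ∃ m : ℕ, S.series ⊤ m = ⊥

/-- Two Lie triple systems are isomorphic if some linear bijection preserves the bracket. -/
def Isomorphic (S : LieTripleSystem F T) (S' : LieTripleSystem F T') : Prop :=
  ∃ φ : T ≃ₗ[F] T', ∀ x y z, φ (S.bracket x y z) = S'.bracket (φ x) (φ y) (φ z)

end General

section Tables

variable (F : Type*) [Field F]

/-- The trilinear map on `F⁴` with `[e_i, e_j, e_k] = e_l`, `[e_j, e_i, e_k] = -e_l` (for `i ≠ j`)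
and all other products of the standard basis vectors zero. -/
def elem (i j k l : Fin 4) :
    (Fin 4 → F) →ₗ[F] (Fin 4 → F) →ₗ[F] (Fin 4 → F) →ₗ[F] (Fin 4 → F) :=
  LinearMap.mk₂ F
    (fun x y => (x i * y j - x j * y i) •
      (LinearMap.proj k : (Fin 4 → F) →ₗ[F] F).smulRight (Pi.single l (1 : F)))
    (fun x x' y => by rw [← add_smul]; congr 1; simp only [Pi.add_apply]; ring)
    (fun c x y => by rw [smul_smul]; congr 1; simp only [Pi.smul_apply, smul_eq_mul]; ring)
    (fun x y y' => by rw [← add_smul]; congr 1; simp only [Pi.add_apply]; ring)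
    (fun c x y => by rw [smul_smul]; congr 1; simp only [Pi.smul_apply, smul_eq_mul]; ring)

theorem elem_apply (i j k l : Fin 4) (x y z : Fin 4 → F) :
    elem F i j k l x y z = ((x i * y j - x j * y i) * z k) • Pi.single l (1 : F) := by
  simp [elem, smul_smul]

/-! The standard basis `e₁, e₂, e₃, e₄` of `F⁴` is indexed by `0, 1, 2, 3 : Fin 4`, so that
`elem F 0 1 0 2` stands for `[e₁, e₂, e₁] = e₃`. Products of basis vectors that are neither
listed nor obtained from a listed one by exchanging the first two arguments are zero. -/

/-- The abelian Lie triple system of dimension four. -/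
def T41 : LieTripleSystem F (Fin 4 → F) where
  bracket := 0
  skew x y z := by simp
  cyclic x y z := by simp
  derivation u v x y z := by simp

/-- `[e₁, e₂, e₁] = e₃`. -/
def T42 : LieTripleSystem F (Fin 4 → F) where
  bracket := elem F 0 1 0 2
  skew x y z := by ext t; fin_cases t <;> simp [elem_apply]; ring
  cyclic x y z := by ext t; fin_cases t <;> simp [elem_apply]; ring
  derivation u v x y z := by ext t; fin_cases t <;> simp [elem_apply]

/-- `[e₁, e₂, e₁] = e₃`, `[e₁, e₂, e₂] = e₄`. -/
def T43 : LieTripleSystem F (Fin 4 → F) where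
  bracket := elem F 0 1 0 2 + elem F 0 1 1 3
  skew x y z := by ext t; fin_cases t <;> simp [elem_apply] <;> ring
  cyclic x y z := by ext t; fin_cases t <;> simp [elem_apply] <;> ring
  derivation u v x y z := by ext t; fin_cases t <;> simp [elem_apply]

/-- `[e₂, e₃, e₂] = e₄`, `[e₃, e₁, e₃] = e₄`. -/
def T44 : LieTripleSystem F (Fin 4 → F) where
  bracket := elem F 1 2 1 3 + elem F 2 0 2 3
  skew x y z := by ext t; fin_cases t <;> simp [elem_apply] <;> ring
  cyclic x y z := by ext t; fin_cases t <;> simp [elem_apply] <;> ring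
  derivation u v x y z := by ext t; fin_cases t <;> simp [elem_apply]

/-- `[e₂, e₃, e₁] = e₄`, `[e₃, e₁, e₂] = e₄`, `[e₂, e₁, e₃] = 2 e₄`, `[e₂, e₃, e₂] = e₄`. -/
def T45 : LieTripleSystem F (Fin 4 → F) where
  bracket := elem F 1 2 0 3 + elem F 2 0 1 3 + (2 : F) • elem F 1 0 2 3 + elem F 1 2 1 3
  skew x y z := by ext t; fin_cases t <;> simp [elem_apply] <;> ring
  cyclic x y z := by ext t; fin_cases t <;> simp [elem_apply] <;> ring
  derivation u v x y z := by ext t; fin_cases t <;> simp [elem_apply]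

/-- `[e₁, e₂, e₃] = -(a + 1) e₄`, `[e₂, e₃, e₁] = a e₄`, `[e₃, e₁, e₂] = e₄`. -/
def T46 (a : F) : LieTripleSystem F (Fin 4 → F) where
  bracket := (-(a + 1)) • elem F 0 1 2 3 + a • elem F 1 2 0 3 + elem F 2 0 1 3
  skew x y z := by ext t; fin_cases t <;> simp [elem_apply] <;> ring
  cyclic x y z := by ext t; fin_cases t <;> simp [elem_apply] <;> ring
  derivation u v x y z := by ext t; fin_cases t <;> simp [elem_apply]

/-- `[e₁, e₂, e₁] = e₃`, `[e₁, e₂, e₃] = e₄`, `[e₁, e₃, e₂] = e₄`. -/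
def T47 : LieTripleSystem F (Fin 4 → F) where
  bracket := elem F 0 1 0 2 + elem F 0 1 2 3 + elem F 0 2 1 3
  skew x y z := by ext t; fin_cases t <;> simp [elem_apply] <;> ring
  cyclic x y z := by ext t; fin_cases t <;> simp [elem_apply] <;> ring
  derivation u v x y z := by ext t; fin_cases t <;> simp [elem_apply] <;> ring

/-- `[e₁, e₂, e₁] = e₃`, `[e₁, e₃, e₁] = e₄`, `[e₁, e₂, e₂] = e₄`. -/
def T48 : LieTripleSystem F (Fin 4 → F) where
  bracket := elem F 0 1 0 2 + elem F 0 2 0 3 + elem F 0 1 1 3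
  skew x y z := by ext t; fin_cases t <;> simp [elem_apply] <;> ring
  cyclic x y z := by ext t; fin_cases t <;> simp [elem_apply] <;> ring
  derivation u v x y z := by ext t; fin_cases t <;> simp [elem_apply] <;> ring

/-- `[e₁, e₂, e₁] = e₃`, `[e₁, e₃, e₁] = e₄`. -/
def T49 : LieTripleSystem F (Fin 4 → F) where
  bracket := elem F 0 1 0 2 + elem F 0 2 0 3
  skew x y z := by ext t; fin_cases t <;> simp [elem_apply] <;> ring
  cyclic x y z := by ext t; fin_cases t <;> simp [elem_apply] <;> ring
  derivation u v x y z := by ext t; fin_cases t <;> simp [elem_apply] <;> ring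

/-- The names in the list of four-dimensional systems; `t6 a` names the member with parameter `a`
of the one-parameter family. -/
inductive Label where
  | t1 | t2 | t3 | t4 | t5
  | t6 (a : F)
  | t7 | t8 | t9

variable {F}

/-- The Lie triple system with a given name. -/
def Label.system : Label F → LieTripleSystem F (Fin 4 → F)
  | .t1 => T41 F
  | .t2 => T42 F
  | .t3 => T43 F
  | .t4 => T44 F
  | .t5 => T45 F
  | .t6 a => T46 F a
  | .t7 => T47 F
  | .t8 => T48 F
  | .t9 => T49 F

/-- `ξ(a) = (a² + a + 1)³ / (a² (a + 1)²)`, meaningful for `a² + a ≠ 0`. -/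
def xi (a : F) : F :=
  (a ^ 2 + a + 1) ^ 3 / (a ^ 2 * (a + 1) ^ 2)

end Tables

end LieTripleSystem

/-! Write `b 0, …, b 3` as e₁, …, e₄. Nilpotency gives a flag basis: e₄ is central, [e₃,T,T] lies in
⟨e₄⟩ and [e₂,T,T] lies in ⟨e₃,e₄⟩ (`IsNilpotent.exists_flag_basis`). Since e₄ drops out and e₃ only
produces multiples of e₄, the e₃-components of [e₁,e₂,e₁] and [e₁,e₂,e₂] split the classification
into two cases.

If both vanish, every product is a multiple of e₄ and the bracket lives on the 3-dimensional
quotient by e₄. As Λ²V ≅ V* for dim V = 3, it has the form det(x, y, Az) e₄; the cyclic identity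
says tr A = 0 and the derivation identity is void (`matSys`). For A ≠ 0, isomorphism of two such
systems means similarity of matrices up to a nonzero scalar (`matSys_isomorphic_of_conj`,
`exists_conj_of_matSys_isomorphic`). Jordan forms of traceless 3 × 3 matrices up to scaling then
give T41, T42, T44, T45 and the family T46 (`exists_label_matSys`).

Otherwise the basis can be chosen with [e₁,e₂,e₁] = e₃ and [e₁,e₂,e₂] ∈ ⟨e₄⟩, and the derivation
identity leaves three parameters (`exists_isomorphic_filiform`). Explicit base changes normalise
these to T42, T43, T47, T48 or T49 (`exists_label_filiform`).

Different types are separated by isomorphism invariants (`Label.kind_eq_of_isomorphic`). Within T46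
the matrix has eigenvalues α, 1, -(α+1); scaling by c multiplies the determinant by c³ and tr A² by
c², so ξ is, up to a constant, the scale-free quotient (tr A²)³/(det A)². Conversely ξ(α) = ξ(β)
factors into six equations, one for each ordering of the eigenvalues. -/

namespace LieTripleSystem

/-! ### Isomorphisms and formal consequences of the axioms. -/

section Basic

variable {F T T' T'' : Type*} [Field F] [AddCommGroup T] [Module F T] [AddCommGroup T']
  [Module F T'] [AddCommGroup T''] [Module F T'']

theorem Isomorphic.refl (S : LieTripleSystem F T) : S.Isomorphic S :=
  ⟨LinearEquiv.refl F T, fun _ _ _ => rfl⟩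

theorem Isomorphic.symm {S : LieTripleSystem F T} {S' : LieTripleSystem F T'}
    (h : S.Isomorphic S') : S'.Isomorphic S := by
  obtain ⟨φ, hφ⟩ := h
  refine ⟨φ.symm, fun x y z => ?_⟩
  rw [LinearEquiv.symm_apply_eq, hφ]
  simp

theorem Isomorphic.trans {S : LieTripleSystem F T} {S' : LieTripleSystem F T'}
    {S'' : LieTripleSystem F T''} (h : S.Isomorphic S') (h' : S'.Isomorphic S'') :
    S.Isomorphic S'' := by
  obtain ⟨φ, hφ⟩ := h
  obtain ⟨ψ, hψ⟩ := h'
  exact ⟨φ.trans ψ, fun x y z => by simp [hφ, hψ]⟩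

theorem bracket_swap (S : LieTripleSystem F T) (x y z : T) :
    S.bracket x y z = -S.bracket y x z :=
  eq_neg_of_add_eq_zero_left (S.skew x y z)

theorem bracket_self (h2 : (2 : F) ≠ 0) (S : LieTripleSystem F T) (x z : T) :
    S.bracket x x z = 0 := by
  have h := S.skew x x z
  rw [← two_smul F] at h
  exact (smul_eq_zero.mp h).resolve_left h2

/-- Moves the third argument into the skew pair, so that centrality or membership in an ideal need
only be checked for the first argument. -/
theorem bracket_cyclic (S : LieTripleSystem F T) (x y z : T) :
    S.bracket x y z = S.bracket x z y - S.bracket y z x := by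
  have h := S.cyclic x y z
  rw [S.bracket_swap z x y] at h
  rw [← sub_eq_zero, ← h]
  abel

/-- An injective bracket-preserving endomorphism of a finite-dimensional space is an
isomorphism. -/
theorem isomorphic_of_injective [FiniteDimensional F T] {S S' : LieTripleSystem F T}
    (f : T →ₗ[F] T) (hf : Function.Injective f)
    (h : ∀ x y z, f (S.bracket x y z) = S'.bracket (f x) (f y) (f z)) : S.Isomorphic S' :=
  ⟨LinearEquiv.ofInjectiveEndo f hf, fun x y z => by simpa using h x y z⟩

theorem isomorphic_of_matrix {S S' : LieTripleSystem F (Fin 4 → F)}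
    (M : Matrix (Fin 4) (Fin 4) F) (hM : M.det ≠ 0)
    (h : ∀ x y z, M.mulVec (S.bracket x y z) =
      S'.bracket (M.mulVec x) (M.mulVec y) (M.mulVec z)) : S.Isomorphic S' := by
  refine isomorphic_of_injective M.mulVecLin ?_ h
  have := Matrix.mulVec_injective_iff_isUnit.mpr
    ((Matrix.isUnit_iff_isUnit_det M).mpr (isUnit_iff_ne_zero.mpr hM))
  exact this

theorem map_bracket_of_basis {ι : Type*} (S : LieTripleSystem F T) (S' : LieTripleSystem F T')
    (b : Module.Basis ι F T) (φ : T →ₗ[F] T')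
    (h : ∀ i j k, φ (S.bracket (b i) (b j) (b k)) = S'.bracket (φ (b i)) (φ (b j)) (φ (b k)))
    (x y z : T) : φ (S.bracket x y z) = S'.bracket (φ x) (φ y) (φ z) := by
  have h1 : ∀ i j z, φ (S.bracket (b i) (b j) z) = S'.bracket (φ (b i)) (φ (b j)) (φ z) := by
    intro i j z
    have : φ ∘ₗ S.bracket (b i) (b j) = S'.bracket (φ (b i)) (φ (b j)) ∘ₗ φ :=
      b.ext fun k => by simpa using h i j k
    exact LinearMap.congr_fun this z
  have h2 : ∀ i y z, φ (S.bracket (b i) y z) = S'.bracket (φ (b i)) (φ y) (φ z) := by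
    intro i y z
    have : φ ∘ₗ (S.bracket (b i)).flip z = (S'.bracket (φ (b i))).flip (φ z) ∘ₗ φ :=
      b.ext fun k => by simpa using h1 i k z
    exact LinearMap.congr_fun this y
  have : φ ∘ₗ (S.bracket.flip y).flip z = (S'.bracket.flip (φ y)).flip (φ z) ∘ₗ φ :=
    b.ext fun k => by simpa using h2 k y z
  exact LinearMap.congr_fun this x

theorem bracket_central_right (S : LieTripleSystem F T) {w : T}
    (hw : ∀ x y, S.bracket w x y = 0) (x y : T) : S.bracket x w y = 0 := by
  rw [S.bracket_swap, hw, neg_zero]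

theorem bracket_central_last (S : LieTripleSystem F T) {w : T}
    (hw : ∀ x y, S.bracket w x y = 0) (x y : T) : S.bracket x y w = 0 := by
  rw [S.bracket_cyclic, S.bracket_central_right hw, S.bracket_central_right hw, sub_zero]

/-- By skew-symmetry and centrality of the last basis vector, only products with i < j and no index
3 have to be compared. -/
theorem isomorphic_of_basis (h2 : (2 : F) ≠ 0) (S : LieTripleSystem F T)
    (S' : LieTripleSystem F (Fin 4 → F)) (b : Module.Basis (Fin 4) F T)
    (hc : ∀ x y, S.bracket (b 3) x y = 0)
    (hc' : ∀ x y, S'.bracket (Pi.single 3 1) x y = 0)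
    (h : ∀ i j k, i < j → j ≠ 3 → k ≠ 3 → b.equivFun (S.bracket (b i) (b j) (b k)) =
      S'.bracket (Pi.single i 1) (Pi.single j 1) (Pi.single k 1)) : S.Isomorphic S' := by
  refine ⟨b.equivFun, map_bracket_of_basis S S' b b.equivFun.toLinearMap ?_⟩
  have e : ∀ i, b.equivFun (b i) = Pi.single i 1 := fun i => by
    ext t; simp [Pi.single_apply, eq_comm]
  have hlt : ∀ i j k, i < j → b.equivFun (S.bracket (b i) (b j) (b k)) =
      S'.bracket (Pi.single i 1) (Pi.single j 1) (Pi.single k 1) := by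
    intro i j k hij
    by_cases hj : j = 3
    · subst hj
      rw [S.bracket_central_right hc, S'.bracket_central_right hc', map_zero]
    by_cases hk : k = 3
    · subst hk
      rw [S.bracket_central_last hc, S'.bracket_central_last hc', map_zero]
    exact h i j k hij hj hk
  intro i j k
  simp only [LinearEquiv.coe_coe, e]
  rcases lt_trichotomy i j with hij | rfl | hij
  · exact hlt i j k hij
  · rw [S.bracket_self h2, S'.bracket_self h2, map_zero]
  · rw [S.bracket_swap, S'.bracket_swap, map_neg, hlt j i k hij]

end Basic

/-! ### Systems det(x, y, Az) e₄ and similarity up to scalars. -/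

section MatrixSystem

variable {F : Type*} [Field F]

/-- The trilinear map `[x, y, z] = det(x, y, A z) e₄`, for a `3 × 3` matrix `A` acting on the
first three coordinates. -/
def matBracket (A : Matrix (Fin 3) (Fin 3) F) :
    (Fin 4 → F) →ₗ[F] (Fin 4 → F) →ₗ[F] (Fin 4 → F) →ₗ[F] (Fin 4 → F) :=
  A 0 0 • elem F 1 2 0 3 + A 0 1 • elem F 1 2 1 3 + A 0 2 • elem F 1 2 2 3 +
    (A 1 0 • elem F 2 0 0 3 + A 1 1 • elem F 2 0 1 3 + A 1 2 • elem F 2 0 2 3) +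
    (A 2 0 • elem F 0 1 0 3 + A 2 1 • elem F 0 1 1 3 + A 2 2 • elem F 0 1 2 3)

theorem matBracket_apply (A : Matrix (Fin 3) (Fin 3) F) (x y z : Fin 4 → F) :
    matBracket A x y z =
      ((x 1 * y 2 - x 2 * y 1) * (A 0 0 * z 0 + A 0 1 * z 1 + A 0 2 * z 2) +
       (x 2 * y 0 - x 0 * y 2) * (A 1 0 * z 0 + A 1 1 * z 1 + A 1 2 * z 2) +
       (x 0 * y 1 - x 1 * y 0) * (A 2 0 * z 0 + A 2 1 * z 1 + A 2 2 * z 2)) •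
        Pi.single 3 (1 : F) := by
  simp only [matBracket, LinearMap.add_apply, LinearMap.smul_apply, elem_apply, smul_smul,
    ← add_smul]
  congr 1
  ring

/-- The system `[x, y, z] = det(x, y, A z) e₄`, for a traceless `3 × 3` matrix `A` acting on the
first three coordinates. -/
def matSys (A : Matrix (Fin 3) (Fin 3) F) (hA : A.trace = 0) :
    LieTripleSystem F (Fin 4 → F) where
  bracket := matBracket A
  skew x y z := by
    simp only [matBracket_apply, ← add_smul]
    rw [smul_eq_zero]
    left
    ring
  cyclic x y z := by
    rw [Matrix.trace_fin_three] at hA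
    simp only [matBracket_apply, ← add_smul]
    rw [smul_eq_zero]
    left
    -- The cyclic sum of det(x, y, Az) is tr A · det(x, y, z); the coefficient is det(x, y, z)
    -- expanded.
    linear_combination (x 0 * y 1 * z 2 - x 0 * y 2 * z 1 - x 1 * y 0 * z 2 + x 1 * y 2 * z 0 +
      x 2 * y 0 * z 1 - x 2 * y 1 * z 0) * hA
  derivation u v x y z := by
    -- Products are multiples of e₄, while the bracket reads only the first three coordinates; all
    -- four terms vanish.
    have h : ∀ i : Fin 4, i ≠ 3 → ∀ c : F, (c • Pi.single 3 (1 : F) : Fin 4 → F) i = 0 :=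
      fun i hi c => by simp [hi]
    simp only [matBracket_apply, h 0 (by decide), h 1 (by decide), h 2 (by decide)]
    simp

theorem matSys_bracket (A : Matrix (Fin 3) (Fin 3) F) (hA : A.trace = 0) (x y z : Fin 4 → F) :
    (matSys A hA).bracket x y z =
      ((x 1 * y 2 - x 2 * y 1) * (A 0 0 * z 0 + A 0 1 * z 1 + A 0 2 * z 2) +
       (x 2 * y 0 - x 0 * y 2) * (A 1 0 * z 0 + A 1 1 * z 1 + A 1 2 * z 2) +
       (x 0 * y 1 - x 1 * y 0) * (A 2 0 * z 0 + A 2 1 * z 1 + A 2 2 * z 2)) •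
        Pi.single 3 (1 : F) :=
  matBracket_apply A x y z

/-- Since det(Px, Py, BPz) = c det(Px, Py, PAz) = c det P · det(x, y, Az), acting by P on the first
three coordinates and by c det P on e₄ preserves the brackets. -/
theorem matSys_isomorphic_of_conj {A B : Matrix (Fin 3) (Fin 3) F} (hA : A.trace = 0)
    (hB : B.trace = 0) (P : Matrix (Fin 3) (Fin 3) F) (hP : P.det ≠ 0) (c : F) (hc : c ≠ 0)
    (h : B * P = c • (P * A)) : (matSys A hA).Isomorphic (matSys B hB) := by
  have hd : P.det = P 0 0 * P 1 1 * P 2 2 - P 0 0 * P 1 2 * P 2 1 - P 0 1 * P 1 0 * P 2 2 +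
    P 0 1 * P 1 2 * P 2 0 + P 0 2 * P 1 0 * P 2 1 - P 0 2 * P 1 1 * P 2 0 := Matrix.det_fin_three P
  refine isomorphic_of_matrix !![P 0 0, P 0 1, P 0 2, 0; P 1 0, P 1 1, P 1 2, 0;
    P 2 0, P 2 1, P 2 2, 0; 0, 0, 0, c * P.det] ?_ ?_
  · have : Matrix.det !![P 0 0, P 0 1, P 0 2, 0; P 1 0, P 1 1, P 1 2, 0;
        P 2 0, P 2 1, P 2 2, 0; 0, 0, 0, c * P.det] = P.det * (c * P.det) := by
      rw [Matrix.det_succ_row_zero]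
      simp [Fin.sum_univ_succ, Matrix.det_fin_three, Fin.succAbove]
      ring
    rw [this]
    exact mul_ne_zero hP (mul_ne_zero hc hP)
  · intro x y z
    have e : ∀ i, B i 0 * (P 0 0 * z 0 + P 0 1 * z 1 + P 0 2 * z 2) +
        B i 1 * (P 1 0 * z 0 + P 1 1 * z 1 + P 1 2 * z 2) +
        B i 2 * (P 2 0 * z 0 + P 2 1 * z 1 + P 2 2 * z 2) =
        c * (P i 0 * (A 0 0 * z 0 + A 0 1 * z 1 + A 0 2 * z 2) +
          P i 1 * (A 1 0 * z 0 + A 1 1 * z 1 + A 1 2 * z 2) +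
          P i 2 * (A 2 0 * z 0 + A 2 1 * z 1 + A 2 2 * z 2)) := by
      intro i
      have h0 := congr_fun₂ h i 0
      have h1 := congr_fun₂ h i 1
      have h2 := congr_fun₂ h i 2
      simp only [Matrix.mul_apply, Fin.sum_univ_three, Matrix.smul_apply, smul_eq_mul] at h0 h1 h2
      linear_combination z 0 * h0 + z 1 * h1 + z 2 * h2
    rw [matSys_bracket, matSys_bracket]
    ext t
    fin_cases t <;> simp [Matrix.mulVec, dotProduct, Fin.sum_univ_four]
    rw [e 0, e 1, e 2, hd]
    ring

/-- A change of basis of `F³` bringing `A` into the shape `c B` yields an isomorphism. -/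
theorem matSys_isomorphic_of_vectors {A B : Matrix (Fin 3) (Fin 3) F} (hA : A.trace = 0)
    (hB : B.trace = 0) (c : F) (hc : c ≠ 0) (v : Fin 3 → Fin 3 → F) (hv : LinearIndependent F v)
    (h : ∀ j, A.mulVec (v j) = c • ∑ i, B i j • v i) :
    (matSys A hA).Isomorphic (matSys B hB) := by
  -- With V the matrix of columns v j, the hypothesis reads AV = cVB, which gives a map from the
  -- system of B to that of A; hence the final `symm`.
  refine (matSys_isomorphic_of_conj hB hA (Matrix.of v).transpose ?_ c hc ?_).symm
  · rw [Matrix.det_transpose]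
    have := (Matrix.linearIndependent_rows_iff_isUnit (A := Matrix.of v)).mp hv
    exact ((Matrix.isUnit_iff_isUnit_det _).mp this).ne_zero
  · ext i j
    have := congr_fun (h j) i
    simp only [Pi.smul_apply, Finset.sum_apply, smul_eq_mul] at this
    simp only [Matrix.mul_apply, Matrix.smul_apply, smul_eq_mul, Matrix.transpose_apply,
      Matrix.of_apply]
    rw [show ∑ x, v x i * B x j = ∑ x, B x j * v x i from
      Finset.sum_congr rfl fun _ _ => mul_comm _ _, ← this]
    rfl

/-- For A ≠ 0 the products span ⟨e₄⟩, so an isomorphism preserves that line, say e₄ ↦ s e₄, and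
induces P on the quotient. Comparing s det(x, y, Az) with det(Px, Py, BPz) = det P · det(x, y,
P⁻¹BPz) gives the scalar s / det P. For A = 0 the line ⟨e₄⟩ need not be preserved. -/
theorem exists_conj_of_matSys_isomorphic {A B : Matrix (Fin 3) (Fin 3) F} {hA : A.trace = 0}
    {hB : B.trace = 0} (h : (matSys A hA).Isomorphic (matSys B hB)) (hA0 : A ≠ 0) :
    ∃ P : Matrix (Fin 3) (Fin 3) F, P.det ≠ 0 ∧ ∃ c : F, c ≠ 0 ∧ B * P = c • (P * A) := by
  obtain ⟨φ, hφ⟩ := h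
  have hval : ∀ x y z, ∃ k : F, (matSys B hB).bracket x y z = k • Pi.single 3 (1 : F) :=
    fun x y z => ⟨_, matSys_bracket B hB x y z⟩
  obtain ⟨s, hs⟩ : ∃ s : F, φ (Pi.single 3 1) = s • Pi.single 3 (1 : F) := by
    obtain ⟨i, j, hij⟩ : ∃ i j, A i j ≠ 0 := by
      by_contra! H
      exact hA0 (Matrix.ext H)
    obtain ⟨x, y, z, hxyz⟩ : ∃ x y z, (matSys A hA).bracket x y z =
        A i j • Pi.single 3 (1 : F) := by
      -- For cyclically consecutive indices i, i+1, i+2, det(e_{i+1}, e_{i+2}, ·) is the i-th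
      -- coordinate, so this product isolates the entry A i j.
      refine ⟨Pi.single (![1, 2, 0] i) 1, Pi.single (![2, 0, 1] i) 1, Pi.single j.castSucc 1, ?_⟩
      rw [matSys_bracket]
      congr 1
      fin_cases i <;> fin_cases j <;> simp
    obtain ⟨k, hk⟩ := hval (φ x) (φ y) (φ z)
    refine ⟨(A i j)⁻¹ * k, ?_⟩
    have e := hφ x y z
    rw [hxyz, map_smul, hk] at e
    rw [mul_smul, ← e, smul_smul, inv_mul_cancel₀ hij, one_smul]
  have hs0 : s ≠ 0 := by
    rintro rfl
    rw [zero_smul, map_eq_zero_iff φ φ.injective] at hs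
    simpa using congr_fun hs 3
  let P : Matrix (Fin 3) (Fin 3) F := Matrix.of fun i j => φ (Pi.single j.castSucc 1) i.castSucc
  have hsum : ∀ x : Fin 4 → F, φ x = x 0 • φ (Pi.single 0 1) + x 1 • φ (Pi.single 1 1) +
      x 2 • φ (Pi.single 2 1) + x 3 • φ (Pi.single 3 1) := by
    intro x
    simp only [← map_smul, ← map_add]
    congr 1
    ext t
    fin_cases t <;> simp
  have hPx : ∀ (x : Fin 4 → F) (i : Fin 3),
      φ x i.castSucc = P i 0 * x 0 + P i 1 * x 1 + P i 2 * x 2 := by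
    intro x i
    rw [hsum x, hs]
    have : (Pi.single 3 1 : Fin 4 → F) i.castSucc = 0 := by fin_cases i <;> rfl
    simp only [Pi.add_apply, Pi.smul_apply, smul_eq_mul, this, P, Matrix.of_apply]
    simp only [Fin.castSucc_zero, Fin.castSucc_one, show Fin.castSucc (2 : Fin 3) = 2 from rfl]
    ring
  have hdet : P.det ≠ 0 := by
    intro h0
    obtain ⟨v, hv, hPv⟩ := Matrix.exists_mulVec_eq_zero_iff.mpr h0
    -- A kernel vector of P lifts to a vector sent into ⟨e₄⟩, which is already the image of ⟨e₄⟩;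
    -- injectivity then forces it to be zero.
    have hφv : φ (Fin.snoc v 0 : Fin 4 → F) =
        φ ((s⁻¹ * φ (Fin.snoc v 0 : Fin 4 → F) 3) • Pi.single 3 1) := by
      rw [map_smul, hs, smul_smul, mul_right_comm, inv_mul_cancel₀ hs0, one_mul]
      ext t
      refine Fin.lastCases ?_ (fun i => ?_) t
      · change φ (Fin.snoc v 0 : Fin 4 → F) 3 = _
        simp [show Fin.last 3 = 3 from rfl]
      · rw [hPx]
        have := congr_fun hPv i
        simp only [Matrix.mulVec, dotProduct, Fin.sum_univ_three, Pi.zero_apply] at this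
        have h3 : (Pi.single 3 1 : Fin 4 → F) i.castSucc = 0 := by fin_cases i <;> rfl
        rw [Pi.smul_apply, h3, smul_zero, ← this]
        rfl
    refine hv (funext fun i => ?_)
    have := congr_fun (φ.injective hφv) i.castSucc
    rw [Fin.snoc_castSucc] at this
    rw [this]
    have h3 : (Pi.single 3 1 : Fin 4 → F) i.castSucc = 0 := by fin_cases i <;> rfl
    simp [h3]
  refine ⟨P, hdet, s / P.det, div_ne_zero hs0 hdet, ?_⟩
  obtain ⟨C, hC⟩ : ∃ C, P * C = B * P :=
    ⟨P⁻¹ * (B * P), Matrix.mul_nonsing_inv_cancel_left _ _ (isUnit_iff_ne_zero.mpr hdet)⟩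
  have hCA : P.det • C = s • A := by
    have hd := Matrix.det_fin_three P
    have key : ∀ (x y : Fin 4 → F) (k : Fin 3),
        P.det * ((x 1 * y 2 - x 2 * y 1) * C 0 k + (x 2 * y 0 - x 0 * y 2) * C 1 k +
          (x 0 * y 1 - x 1 * y 0) * C 2 k) =
        s * ((x 1 * y 2 - x 2 * y 1) * A 0 k + (x 2 * y 0 - x 0 * y 2) * A 1 k +
          (x 0 * y 1 - x 1 * y 0) * A 2 k) := by
      intro x y k
      have e := congr_fun (hφ x y (Pi.single k.castSucc 1)) 3
      rw [matSys_bracket, matSys_bracket, map_smul, hs] at e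
      have p0 := hPx x 0
      have p1 := hPx x 1
      have p2 := hPx x 2
      have q0 := hPx y 0
      have q1 := hPx y 1
      have q2 := hPx y 2
      have r0 : φ (Pi.single k.castSucc 1) 0 = P 0 k := rfl
      have r1 : φ (Pi.single k.castSucc 1) 1 = P 1 k := rfl
      have r2 : φ (Pi.single k.castSucc 1) 2 = P 2 k := rfl
      simp only [Fin.castSucc_zero, Fin.castSucc_one,
        show Fin.castSucc (2 : Fin 3) = 2 from rfl] at p0 p1 p2 q0 q1 q2
      have c0 := congr_fun₂ hC 0 k
      have c1 := congr_fun₂ hC 1 k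
      have c2 := congr_fun₂ hC 2 k
      simp only [Matrix.mul_apply, Fin.sum_univ_three] at c0 c1 c2
      rw [p0, p1, p2, q0, q1, q2, r0, r1, r2, ← c0, ← c1, ← c2] at e
      have a : ∀ i, A i 0 * (Pi.single k.castSucc 1 : Fin 4 → F) 0 +
          A i 1 * (Pi.single k.castSucc 1 : Fin 4 → F) 1 +
          A i 2 * (Pi.single k.castSucc 1 : Fin 4 → F) 2 = A i k := by
        intro i
        fin_cases k <;> simp
      rw [a, a, a] at e
      simp only [Pi.smul_apply, smul_eq_mul, Pi.single_eq_same, mul_one] at e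
      rw [hd]
      linear_combination -e
    ext i k
    have k0 := key (Pi.single 1 1) (Pi.single 2 1) k
    have k1 := key (Pi.single 2 1) (Pi.single 0 1) k
    have k2 := key (Pi.single 0 1) (Pi.single 1 1) k
    simp at k0 k1 k2
    fin_cases i <;> simpa
  rw [← hC, div_eq_inv_mul, mul_smul, ← Matrix.mul_smul, ← hCA, Matrix.mul_smul, smul_smul,
    inv_mul_cancel₀ hdet, one_smul]

end MatrixSystem

/-! ### Jordan forms of traceless 3 × 3 matrices up to scaling. -/

section Jordan

variable {F : Type*} [Field F]

@[ext]
theorem ext {T : Type*} [AddCommGroup T] [Module F T] {S S' : LieTripleSystem F T}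
    (h : S.bracket = S'.bracket) : S = S' := by
  cases S; cases S'; congr

theorem T41_eq_matSys : T41 F = matSys 0 (by simp) := by
  ext x y z t
  simp [T41, matSys_bracket]

theorem T44_eq_matSys :
    T44 F = matSys !![0, 1, 0; 0, 0, 1; 0, 0, 0] (by simp [Matrix.trace_fin_three]) := by
  ext x y z t
  simp [T44, matSys_bracket, elem_apply]
  ring

theorem T45_eq_matSys :
    T45 F = matSys !![1, 1, 0; 0, 1, 0; 0, 0, -2]
      (by simp [Matrix.trace_fin_three]; norm_num) := by
  ext x y z t
  simp [T45, matSys_bracket, elem_apply]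
  ring

theorem T46_eq_matSys (a : F) :
    T46 F a = matSys !![a, 0, 0; 0, 1, 0; 0, 0, -(a + 1)] (by simp [Matrix.trace_fin_three]) := by
  ext x y z t
  simp [T46, matSys_bracket, elem_apply]
  ring

theorem T42_isomorphic_matSys : (T42 F).Isomorphic
    (matSys !![0, 0, 0; 0, 0, 0; 1, 0, 0] (by simp [Matrix.trace_fin_three])) := by
  refine isomorphic_of_matrix !![1, 0, 0, 0; 0, 1, 0, 0; 0, 0, 0, 1; 0, 0, 1, 0] ?_ ?_
  · rw [Matrix.det_succ_row_zero]
    simp [Fin.sum_univ_succ, Matrix.det_fin_three, Fin.succAbove]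
  · intro x y z
    rw [matSys_bracket]
    ext t
    fin_cases t <;> simp [T42, elem_apply, Matrix.mulVec, dotProduct, Fin.sum_univ_four]

theorem linearIndependent_triple {V : Type*} [AddCommGroup V] [Module F V] {u v w : V}
    (h : ∀ a b c : F, a • u + b • v + c • w = 0 → a = 0 ∧ b = 0 ∧ c = 0) :
    LinearIndependent F ![u, v, w] := by
  rw [Fintype.linearIndependent_iff]
  intro g hg
  simp only [Fin.sum_univ_three, Matrix.cons_val] at hg
  obtain ⟨h0, h1, h2⟩ := h _ _ _ hg
  intro i
  fin_cases i <;> assumption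

theorem exists_eigenvector_of_mem_roots {A : Matrix (Fin 3) (Fin 3) F} {μ : F}
    (h : μ ∈ A.charpoly.roots) : ∃ v, v ≠ 0 ∧ A.mulVec v = μ • v := by
  have h1 : μ ∈ spectrum F A :=
    Matrix.mem_spectrum_iff_isRoot_charpoly.mpr (Polynomial.isRoot_of_mem_roots h)
  rw [← Matrix.spectrum_toLin', ← Module.End.hasEigenvalue_iff_mem_spectrum] at h1
  obtain ⟨v, hv⟩ := h1.exists_hasEigenvector
  exact ⟨v, hv.2, by simpa using hv.apply_eq_smul⟩

/-- The characteristic polynomial splits: its root sum is the trace, and the matrix product is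
Cayley–Hamilton. -/
theorem exists_eigenvalues [IsAlgClosed F] (A : Matrix (Fin 3) (Fin 3) F) (hA : A.trace = 0) :
    ∃ a b c : F, a + b + c = 0 ∧ (A - a • 1) * (A - b • 1) * (A - c • 1) = 0 ∧
      ∀ μ, μ = a ∨ μ = b ∨ μ = c → ∃ v, v ≠ 0 ∧ A.mulVec v = μ • v := by
  have hs := IsAlgClosed.splits A.charpoly
  have hcard : A.charpoly.roots.card = 3 := by
    rw [← hs.natDegree_eq_card_roots, Matrix.charpoly_natDegree_eq_dim, Fintype.card_fin]
  obtain ⟨a, b, c, h⟩ := Multiset.card_eq_three.mp hcard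
  refine ⟨a, b, c, ?_, ?_, fun μ hμ => exists_eigenvector_of_mem_roots (by rw [h]; simpa using hμ)⟩
  · rw [Matrix.trace_eq_sum_roots_charpoly, h] at hA
    simpa [add_assoc] using hA
  · have h1 := hs.eq_prod_roots_of_monic A.charpoly_monic
    have h2 := A.aeval_self_charpoly
    rw [h1, h] at h2
    simpa [mul_assoc, Algebra.algebraMap_eq_smul_one] using h2

/-- Dividing the spectrum by b gives a/b, 1, c/b, and c/b = -(a/b + 1) because the trace is zero. -/
theorem exists_label_of_distinct {A : Matrix (Fin 3) (Fin 3) F} (hA : A.trace = 0) {a b c : F}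
    (hsum : a + b + c = 0) (hb : b ≠ 0) (hab : a ≠ b) (hac : a ≠ c) (hbc : b ≠ c)
    (h : ∀ μ, μ = a ∨ μ = b ∨ μ = c → ∃ v, v ≠ 0 ∧ A.mulVec v = μ • v) :
    ∃ l : Label F, (matSys A hA).Isomorphic l.system := by
  refine ⟨.t6 (a / b), ?_⟩
  rw [Label.system, T46_eq_matSys]
  obtain ⟨u, hu, hAu⟩ := h a (by simp)
  obtain ⟨v, hv, hAv⟩ := h b (by simp)
  obtain ⟨w, hw, hAw⟩ := h c (by simp)
  refine matSys_isomorphic_of_vectors hA _ b hb ![u, v, w] ?_ ?_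
  · refine Module.End.eigenvectors_linearIndependent' (Matrix.toLin' A) ![a, b, c] ?_ _ ?_
    · intro i j hij
      fin_cases i <;> fin_cases j <;> simp_all
    · intro i
      rw [Module.End.hasEigenvector_iff, Module.End.mem_eigenspace_iff]
      fin_cases i
      · exact ⟨by simpa using hAu, hu⟩
      · exact ⟨by simpa using hAv, hv⟩
      · exact ⟨by simpa using hAw, hw⟩
  · intro j
    fin_cases j
    · simp [Fin.sum_univ_three, hAu, smul_smul, mul_div_cancel₀ _ hb]
    · simp [Fin.sum_univ_three, hAv]
    · simp only [Fin.sum_univ_three]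
      simp [hAw, smul_smul, -neg_add_rev, -neg_smul]
      congr 1
      field_simp
      linear_combination hsum

/-- Eigenvalues a, a, -2a, with a ≠ -2a because 3 ≠ 0. Up to the scalar a the diagonalisable case is
diag(1, 1, -2); otherwise a has a Jordan block of size two. -/
theorem exists_label_of_double (h2 : (2 : F) ≠ 0) (h3 : (3 : F) ≠ 0)
    {A : Matrix (Fin 3) (Fin 3) F} (hA : A.trace = 0) {a : F} (ha : a ≠ 0)
    (hp : (A - a • 1) * (A - a • 1) * (A + (2 * a) • 1) = 0)
    (h : ∃ v, v ≠ 0 ∧ A.mulVec v = (-(2 * a)) • v) :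
    ∃ l : Label F, (matSys A hA).Isomorphic l.system := by
  obtain ⟨w, hw, hAw⟩ := h
  have h3a : -(2 * a) - a ≠ 0 := by
    rw [show -(2 * a) - a = -(3 * a) by ring]
    exact neg_ne_zero.mpr (mul_ne_zero h3 ha)
  by_cases hss : (A - a • 1) * (A + (2 * a) • 1) = 0
  · refine ⟨.t6 1, ?_⟩
    rw [Label.system, T46_eq_matSys]
    -- The projection onto the a-eigenspace along the (-2a)-eigenspace; its trace 6a/(3a) = 2 yields
    -- the dimension.
    let E : (Fin 3 → F) →ₗ[F] (Fin 3 → F) := Matrix.toLin' ((3 * a)⁻¹ • (A + (2 * a) • 1))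
    have hAA : A * A = (2 * a * a) • 1 - a • A := by
      have : (A - a • 1) * (A + (2 * a) • 1) = A * A + a • A - (2 * a * a) • 1 := by
        simp only [sub_mul, mul_add, smul_mul_assoc, mul_smul_comm, one_mul, mul_one]
        module
      rw [this] at hss
      rw [← sub_eq_zero, ← hss]
      abel
    have hE : IsIdempotentElem E := by
      change E ∘ₗ E = E
      rw [← Matrix.toLin'_mul]
      congr 1
      have : (A + (2 * a) • 1) * (A + (2 * a) • 1) = (3 * a) • (A + (2 * a) • 1) := by
        rw [add_mul, mul_add, hAA]
        ext i j
        simp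
        ring
      rw [smul_mul_smul_comm, this, smul_smul]
      congr 1
      field_simp
    have htr : LinearMap.trace F _ E = 2 := by
      rw [Matrix.trace_toLin'_eq]
      simp only [Matrix.trace_smul, Matrix.trace_add, hA, Matrix.trace_one]
      simp
      field_simp
    rw [(LinearMap.IsIdempotentElem.isProj_range E hE).trace] at htr
    -- The trace determines the rank only as an element of F; the bound rank ≤ 3 and 2 ≠ 0 recover
    -- the integer.
    have hr : Module.finrank F (LinearMap.range E) = 2 := by
      have hle : Module.finrank F (LinearMap.range E) ≤ 3 := by
        simpa using Submodule.finrank_le (LinearMap.range E)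
      generalize Module.finrank F (LinearMap.range E) = r at htr hle
      interval_cases r
      · exact absurd (by simpa using htr.symm) h2
      · exfalso
        apply one_ne_zero (α := F)
        norm_num at htr
        linear_combination -htr
      · rfl
      · exfalso
        apply one_ne_zero (α := F)
        norm_num at htr
        linear_combination htr
    have : Nontrivial (LinearMap.range E) := Module.nontrivial_of_finrank_pos (R := F) (by omega)
    obtain ⟨u, hu⟩ := exists_ne (0 : LinearMap.range E)
    obtain ⟨v, huv⟩ := exists_linearIndependent_pair_of_one_lt_finrank (R := F)
      (by rw [hr]; norm_num) hu
    rw [LinearIndependent.pair_iff] at huv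
    have hK : ∀ x ∈ LinearMap.range E, A.mulVec x = a • x := by
      rintro _ ⟨y, rfl⟩
      have := congr_arg (fun M => (3 * a)⁻¹ • M.mulVec y) hss
      simp only [← Matrix.mulVec_mulVec, Matrix.sub_mulVec, Matrix.zero_mulVec, smul_zero,
        Matrix.smul_mulVec, Matrix.one_mulVec, smul_sub] at this
      rw [sub_eq_zero] at this
      simp only [E, Matrix.toLin'_apply, Matrix.smul_mulVec, Matrix.mulVec_smul]
      rw [this, smul_comm]
    have hu' := hK u u.2
    have hv' := hK v v.2
    refine matSys_isomorphic_of_vectors hA _ a ha ![u, v, w] (linearIndependent_triple ?_) ?_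
    · intro α β γ hz
      have e := congr_arg (fun x => A.mulVec x - a • x) hz
      simp only [Matrix.mulVec_add, Matrix.mulVec_smul, hu', hv', hAw, Matrix.mulVec_zero,
        smul_zero, sub_zero] at e
      have e' : (γ * (-(2 * a) - a)) • w = 0 := by
        rw [← e]
        module
      have hγ : γ = 0 :=
        (mul_eq_zero.mp ((smul_eq_zero.mp e').resolve_right hw)).resolve_right h3a
      subst hγ
      have := huv α β (Subtype.ext (by simpa using hz))
      exact ⟨this.1, this.2, rfl⟩
    · intro j
      fin_cases j
      · simp [Fin.sum_univ_three, hu']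
      · simp [Fin.sum_univ_three, hv']
      · simp only [Fin.sum_univ_three]
        simp [hAw]
        module
  · refine ⟨.t5, ?_⟩
    rw [Label.system, T45_eq_matSys]
    obtain ⟨x, hx⟩ : ∃ x, ((A - a • 1) * (A + (2 * a) • 1)).mulVec x ≠ 0 := by
      by_contra! H
      exact hss (Matrix.ext_of_mulVec_single fun i => by simp only [H, Matrix.zero_mulVec])
    obtain ⟨y, hy⟩ : ∃ y, y = (A + (2 * a) • 1).mulVec x := ⟨_, rfl⟩
    rw [← Matrix.mulVec_mulVec, ← hy] at hx
    have hAu := congr_arg (fun M => M.mulVec x) hp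
    simp only [← Matrix.mulVec_mulVec, ← hy, Matrix.zero_mulVec] at hAu
    obtain ⟨u, hu⟩ : ∃ u, u = (A - a • 1).mulVec y := ⟨_, rfl⟩
    rw [← hu] at hx hAu
    simp only [Matrix.sub_mulVec, Matrix.smul_mulVec, Matrix.one_mulVec] at hAu hu
    have hAu' : A.mulVec u = a • u := sub_eq_zero.mp hAu
    have hAy : A.mulVec y = a • y + u := by rw [hu]; abel
    -- The factor a⁻¹ makes Ay = a(a⁻¹u + y), so that the off-diagonal entry is 1 after taking out
    -- a.
    refine matSys_isomorphic_of_vectors hA _ a ha ![a⁻¹ • u, y, w] (linearIndependent_triple ?_) ?_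
    · intro α β γ hz
      have e := congr_arg (fun x => A.mulVec x - a • x) hz
      simp only [Matrix.mulVec_add, Matrix.mulVec_smul, hAu', hAy, hAw, Matrix.mulVec_zero,
        smul_zero, sub_zero] at e
      have e1 : β • u + (γ * (-(2 * a) - a)) • w = 0 := by
        rw [← e]
        module
      have e2 := congr_arg (fun x => A.mulVec x - a • x) e1
      simp only [Matrix.mulVec_add, Matrix.mulVec_smul, hAu', hAw, Matrix.mulVec_zero,
        smul_zero, sub_zero] at e2
      have e' : (γ * (-(2 * a) - a) * (-(2 * a) - a)) • w = 0 := by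
        rw [← e2]
        module
      have hγ : γ = 0 :=
        (mul_eq_zero.mp ((mul_eq_zero.mp ((smul_eq_zero.mp e').resolve_right hw)).resolve_right
          h3a)).resolve_right h3a
      subst hγ
      have hβ : β = 0 := (smul_eq_zero.mp (by simpa using e1)).resolve_right hx
      subst hβ
      simp only [zero_smul, add_zero, smul_smul] at hz
      exact ⟨(mul_eq_zero.mp ((smul_eq_zero.mp hz).resolve_right hx)).resolve_right
        (inv_ne_zero ha), rfl, rfl⟩
    · intro j
      fin_cases j
      · simp [Fin.sum_univ_three, hAu', Matrix.mulVec_smul, smul_smul, mul_comm]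
      · simp [Fin.sum_univ_three, hAy, smul_smul, ha, add_comm]
      · simp [Fin.sum_univ_three, hAw, smul_smul, mul_comm]

/-- Three nilpotent Jordan types: A = 0, A² = 0 ≠ A, and A² ≠ 0. -/
theorem exists_label_of_cube_eq_zero {A : Matrix (Fin 3) (Fin 3) F} (hA : A.trace = 0)
    (h : A * A * A = 0) : ∃ l : Label F, (matSys A hA).Isomorphic l.system := by
  have hne : ∀ M : Matrix (Fin 3) (Fin 3) F, M ≠ 0 → ∃ x, M.mulVec x ≠ 0 := by
    intro M hM
    by_contra! H
    exact hM (Matrix.ext_of_mulVec_single fun i => by simp only [H, Matrix.zero_mulVec])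
  by_cases h0 : A = 0
  · subst h0
    exact ⟨.t1, by rw [Label.system, T41_eq_matSys]; exact .refl _⟩
  by_cases hAA : A * A = 0
  · refine ⟨.t2, Isomorphic.trans ?_ T42_isomorphic_matSys.symm⟩
    have hAA' : ∀ x, A.mulVec (A.mulVec x) = 0 := fun x => by simp [hAA]
    obtain ⟨v, hv⟩ := hne A h0
    -- A² = 0 puts the range inside the kernel, and their dimensions add up to 3; so some kernel
    -- vector is independent of Av.
    have hker : 2 ≤ Module.finrank F (LinearMap.ker A.mulVecLin) := by
      have h1 := LinearMap.finrank_range_add_finrank_ker A.mulVecLin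
      have h2 : LinearMap.range A.mulVecLin ≤ LinearMap.ker A.mulVecLin := by
        rintro _ ⟨y, rfl⟩
        simp [hAA]
      have h3 := Submodule.finrank_mono h2
      simp only [Module.finrank_fin_fun] at h1
      omega
    obtain ⟨w, hwA, hw⟩ := exists_linearIndependent_pair_of_one_lt_finrank (R := F)
      (x := (⟨A.mulVec v, hAA' v⟩ : LinearMap.ker A.mulVecLin)) hker
      (fun H => hv (congr_arg Subtype.val H)) |>.imp fun w hw => And.intro w.2 hw
    rw [LinearIndependent.pair_iff] at hw
    have hwA' : A.mulVec w.1 = 0 := hwA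
    refine matSys_isomorphic_of_vectors hA _ 1 one_ne_zero ![v, w, A.mulVec v]
      (linearIndependent_triple ?_) ?_
    · intro α β γ hz
      have e := congr_arg A.mulVec hz
      simp only [Matrix.mulVec_add, Matrix.mulVec_smul, hwA', hAA', smul_zero, add_zero,
        Matrix.mulVec_zero] at e
      have hα := (smul_eq_zero.mp e).resolve_right hv
      subst hα
      obtain ⟨h1, h2⟩ := hw γ β (Subtype.ext (by simpa [add_comm] using hz))
      exact ⟨rfl, h2, h1⟩
    · intro j
      fin_cases j
      · simp [Fin.sum_univ_three]
      · simp [Fin.sum_univ_three, hwA']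
      · simp only [Fin.sum_univ_three]
        simp [hAA]
  · refine ⟨.t4, ?_⟩
    rw [Label.system, T44_eq_matSys]
    obtain ⟨v, hv⟩ := hne _ hAA
    rw [← Matrix.mulVec_mulVec] at hv
    have hAAA : A.mulVec (A.mulVec (A.mulVec v)) = 0 := by
      rw [Matrix.mulVec_mulVec, Matrix.mulVec_mulVec, h, Matrix.zero_mulVec]
    refine matSys_isomorphic_of_vectors hA _ 1 one_ne_zero
      ![A.mulVec (A.mulVec v), A.mulVec v, v] (linearIndependent_triple ?_) ?_
    · intro α β γ hz
      have e1 := congr_arg A.mulVec hz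
      simp only [Matrix.mulVec_add, Matrix.mulVec_smul, hAAA, smul_zero, zero_add,
        Matrix.mulVec_zero] at e1
      have e2 := congr_arg A.mulVec e1
      simp only [Matrix.mulVec_add, Matrix.mulVec_smul, hAAA, smul_zero, zero_add,
        Matrix.mulVec_zero] at e2
      have hγ := (smul_eq_zero.mp e2).resolve_right hv
      subst hγ
      rw [zero_smul, add_zero] at e1 hz
      have hβ := (smul_eq_zero.mp e1).resolve_right hv
      subst hβ
      rw [zero_smul, add_zero] at hz
      exact ⟨(smul_eq_zero.mp hz).resolve_right hv, rfl, rfl⟩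
    · intro j
      fin_cases j
      · simp only [Fin.sum_univ_three]
        simp [hAAA, -Matrix.mulVec_mulVec]
      · simp [Fin.sum_univ_three]
      · simp [Fin.sum_univ_three]

/-- Every system `[x, y, z] = det(x, y, A z) e₄` occurs in the list. -/
theorem exists_label_matSys [IsAlgClosed F] (h2 : (2 : F) ≠ 0) (h3 : (3 : F) ≠ 0)
    (A : Matrix (Fin 3) (Fin 3) F) (hA : A.trace = 0) :
    ∃ l : Label F, (matSys A hA).Isomorphic l.system := by
  obtain ⟨a, b, c, hsum, hp, he⟩ := exists_eigenvalues A hA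
  have hcomm : ∀ s t : F, (A - s • 1) * (A - t • 1) = (A - t • 1) * (A - s • 1) := by
    intro s t
    simp only [sub_mul, mul_sub, smul_mul_assoc, mul_smul_comm, one_mul, mul_one]
    module
  have dbl : ∀ s t : F, s + s + t = 0 → (A - s • 1) * (A - s • 1) * (A - t • 1) = 0 →
      (∃ v, v ≠ 0 ∧ A.mulVec v = t • v) →
      ∃ l : Label F, (matSys A hA).Isomorphic l.system := by
    intro s t hst hp hv
    obtain rfl : t = -(2 * s) := by linear_combination hst
    by_cases hs : s = 0
    · subst hs
      exact exists_label_of_cube_eq_zero hA (by simpa using hp)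
    · exact exists_label_of_double h2 h3 hA hs (by simpa using hp) hv
  by_cases hab : a = b
  · subst hab
    exact dbl a c hsum hp (he c (by simp))
  by_cases hac : a = c
  · subst hac
    exact dbl a b (by linear_combination hsum) (by rw [mul_assoc, hcomm a b, ← mul_assoc, hp])
      (he b (by simp))
  by_cases hbc : b = c
  · subst hbc
    exact dbl b a (by linear_combination hsum)
      (by rw [mul_assoc, hcomm b a, ← mul_assoc, hcomm b a, hp]) (he a (by simp))
  -- The eigenvalue used for rescaling must be nonzero; if b = 0, distinctness makes a nonzero, and
  -- the two are exchanged.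
  by_cases hb : b = 0
  · subst hb
    refine exists_label_of_distinct hA (a := 0) (b := a) (c := c) (by linear_combination hsum)
      hab (Ne.symm hab) hbc hac fun μ hμ => he μ (by tauto)
  · exact exists_label_of_distinct hA hsum hb hab hac hbc he

end Jordan

/-! ### A flag basis from nilpotency. -/

section Flag

variable {F T : Type*} [Field F] [AddCommGroup T] [Module F T]

theorem bracket_mem_series_succ (S : LieTripleSystem F T) {n : ℕ} {x : T}
    (hx : x ∈ S.series ⊤ n) (y z : T) : S.bracket x y z ∈ S.series ⊤ (n + 1) := by
  rw [series]
  exact Submodule.mem_sup_left (Submodule.subset_span ⟨x, hx, y, trivial, z, trivial, rfl⟩)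

/-- A nilpotent system has a nonzero central element modulo every proper subspace. -/
theorem IsNilpotent.exists_bracket_mem {S : LieTripleSystem F T} (hS : S.IsNilpotent)
    {W : Submodule F T} (hW : W ≠ ⊤) : ∃ z, z ∉ W ∧ ∀ x y, S.bracket z x y ∈ W := by
  classical
  obtain ⟨m, hm⟩ := hS
  have hex : ∃ n, S.series ⊤ n ≤ W := ⟨m, by rw [hm]; exact bot_le⟩
  -- The first term inside W has positive index, since term 0 is the whole space; any z in the
  -- preceding term outside W works.
  obtain ⟨k, hk⟩ : ∃ k, Nat.find hex = k + 1 := by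
    refine Nat.exists_eq_succ_of_ne_zero fun h0 => hW ?_
    have := Nat.find_spec hex
    rw [h0] at this
    exact top_le_iff.mp this
  have hmin : ¬ S.series ⊤ k ≤ W := Nat.find_min hex (by omega)
  obtain ⟨z, hz, hzW⟩ := SetLike.not_le_iff_exists.mp hmin
  refine ⟨z, hzW, fun x y => ?_⟩
  have := Nat.find_spec hex
  rw [hk] at this
  exact this (S.bracket_mem_series_succ hz x y)

theorem span_range_ne_top {n : ℕ} (hT : Module.finrank F T = 4) (hn : n < 4) (v : Fin n → T) :
    Submodule.span F (Set.range v) ≠ ⊤ := by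
  intro h
  have h1 := finrank_range_le_card (R := F) v
  rw [Set.finrank, h, finrank_top, hT, Fintype.card_fin] at h1
  omega

/-- A basis adapted to a central series. -/
theorem IsNilpotent.exists_flag_basis {S : LieTripleSystem F T} (hT : Module.finrank F T = 4)
    (hS : S.IsNilpotent) : ∃ b : Module.Basis (Fin 4) F T,
      (∀ x y, S.bracket (b 3) x y = 0) ∧
      (∀ x y, S.bracket (b 2) x y ∈ Submodule.span F {b 3}) ∧
      (∀ x y, S.bracket (b 1) x y ∈ Submodule.span F {b 2, b 3}) := by
  have : FiniteDimensional F T := FiniteDimensional.of_finrank_pos (by omega)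
  -- The basis is built from its last vector: each new vector is central modulo the span of those
  -- already chosen.
  obtain ⟨e₄, h4, c4⟩ := hS.exists_bracket_mem (span_range_ne_top hT (by norm_num) ![])
  obtain ⟨e₃, h3, c3⟩ := hS.exists_bracket_mem (span_range_ne_top hT (by norm_num) ![e₄])
  obtain ⟨e₂, h2, c2⟩ := hS.exists_bracket_mem (span_range_ne_top hT (by norm_num) ![e₃, e₄])
  obtain ⟨e₁, h1, c1⟩ := hS.exists_bracket_mem (span_range_ne_top hT (by norm_num) ![e₂, e₃, e₄])
  have hli : LinearIndependent F ![e₁, e₂, e₃, e₄] := by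
    refine linearIndependent_finCons.mpr ⟨?_, h1⟩
    refine linearIndependent_finCons.mpr ⟨?_, h2⟩
    refine linearIndependent_finCons.mpr ⟨?_, h3⟩
    exact linearIndependent_finCons.mpr ⟨linearIndependent_empty_type, h4⟩
  refine ⟨basisOfLinearIndependentOfCardEqFinrank hli (by simp [hT]), ?_⟩
  simp only [coe_basisOfLinearIndependentOfCardEqFinrank]
  simp only [Matrix.cons_val]
  refine ⟨fun x y => by simpa using c4 x y, fun x y => by simpa using c3 x y, fun x y => ?_⟩
  simpa [Set.pair_comm, Set.insert_comm] using c2 x y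

end Flag

/-! ### Reduction of the case of one-dimensional products to matrices. -/

section Rank

variable {F T : Type*} [Field F] [AddCommGroup T] [Module F T]

/-- A system all of whose products are multiples of one central vector is given by a traceless
matrix. -/
theorem exists_isomorphic_matSys (h2 : (2 : F) ≠ 0) (S : LieTripleSystem F T)
    (b : Module.Basis (Fin 4) F T) (hc : ∀ x y, S.bracket (b 3) x y = 0)
    (h : ∀ i j k, i < j → j ≠ 3 → k ≠ 3 →
      S.bracket (b i) (b j) (b k) ∈ Submodule.span F {b 3}) :
    ∃ (A : Matrix (Fin 3) (Fin 3) F) (hA : A.trace = 0), S.Isomorphic (matSys A hA) := by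
  have h' : ∀ i j (k : Fin 3), i < j → j ≠ 3 →
      ∃ a : F, a • b 3 = S.bracket (b i) (b j) (b k.castSucc) := fun i j k hij hj =>
    Submodule.mem_span_singleton.mp (h i j _ hij hj (Fin.castSucc_lt_last k).ne)
  choose p hp using fun k => h' 0 1 k (by decide) (by decide)
  choose q hq using fun k => h' 0 2 k (by decide) (by decide)
  choose r hr using fun k => h' 1 2 k (by decide) (by decide)
  have hcyc := S.cyclic (b 0) (b 1) (b 2)
  rw [S.bracket_swap (b 2) (b 0)] at hcyc
  -- Rows record [e₂,e₃,·], [e₃,e₁,·] = -[e₁,e₃,·] and [e₁,e₂,·]; the trace is the cyclic sum on e₁,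
  -- e₂, e₃.
  have htr : (Matrix.of ![r, -q, p]).trace = 0 := by
    have e1 := hp 2
    have e2 := hq 1
    have e3 := hr 0
    simp only [Fin.castSucc_zero, Fin.castSucc_one,
      show Fin.castSucc (2 : Fin 3) = 2 from rfl] at e1 e2 e3
    rw [← e1, ← e2, ← e3, ← neg_smul, ← add_smul, ← add_smul] at hcyc
    have := (smul_eq_zero.mp hcyc).resolve_right (b.ne_zero 3)
    simp [Matrix.trace_fin_three]
    linear_combination this
  have e3 : b.equivFun (b 3) = Pi.single 3 1 := by
    ext t; simp [Pi.single_apply, eq_comm]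
  refine ⟨Matrix.of ![r, -q, p], htr, isomorphic_of_basis h2 S _ b hc ?_ ?_⟩
  · intro x y
    simp [matSys_bracket]
  · intro i j k hij hj hk
    rw [matSys_bracket]
    obtain ⟨k, rfl⟩ := Fin.exists_castSucc_eq.mpr (show k ≠ Fin.last 3 from hk)
    fin_cases i <;> fin_cases j <;> first | exact absurd hij (by decide) | exact absurd rfl hj | skip
    · change b.equivFun (S.bracket (b 0) (b 1) (b k.castSucc)) = _
      rw [← hp, map_smul, e3]
      fin_cases k <;> simp
    · change b.equivFun (S.bracket (b 0) (b 2) (b k.castSucc)) = _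
      rw [← hq, map_smul, e3]
      fin_cases k <;> simp
    · change b.equivFun (S.bracket (b 1) (b 2) (b k.castSucc)) = _
      rw [← hr, map_smul, e3]
      fin_cases k <;> simp

end Rank

/-! ### The case [e₁,e₂,e₁] = e₃: three parameters and their normal forms. -/

section Filiform

variable {F T : Type*} [Field F] [AddCommGroup T] [Module F T]

/-- The bracket with `[e₁, e₂, e₁] = e₃`, `[e₁, e₂, e₂] = a e₄`,
`[e₁, e₂, e₃] = [e₁, e₃, e₂] = b e₄`, `[e₁, e₃, e₁] = c e₄`. -/
def filiform (a b c : F) : LieTripleSystem F (Fin 4 → F) where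
  bracket := elem F 0 1 0 2 + a • elem F 0 1 1 3 + b • (elem F 0 1 2 3 + elem F 0 2 1 3) +
    c • elem F 0 2 0 3
  skew x y z := by ext t; fin_cases t <;> simp [elem_apply] <;> ring
  cyclic x y z := by ext t; fin_cases t <;> simp [elem_apply] <;> ring
  derivation u v x y z := by ext t; fin_cases t <;> simp [elem_apply] <;> ring

theorem filiform_bracket (a b c : F) (x y z : Fin 4 → F) :
    (filiform a b c).bracket x y z = ![0, 0, (x 0 * y 1 - x 1 * y 0) * z 0,
      a * ((x 0 * y 1 - x 1 * y 0) * z 1) + b * ((x 0 * y 1 - x 1 * y 0) * z 2 +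
        (x 0 * y 2 - x 2 * y 0) * z 1) + c * ((x 0 * y 2 - x 2 * y 0) * z 0)] := by
  ext t; fin_cases t <;> simp [filiform, elem_apply]
  ring

theorem T47_eq_filiform : T47 F = filiform 0 1 0 := by
  ext : 1
  simp [T47, filiform, add_assoc]

theorem T48_eq_filiform : T48 F = filiform 1 0 1 := by
  ext : 1
  simp [T48, filiform]
  abel

theorem T49_eq_filiform : T49 F = filiform 0 0 1 := by
  ext : 1
  simp [T49, filiform]

theorem T42_eq_filiform : T42 F = filiform 0 0 0 := by
  ext : 1
  simp [T42, filiform]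

theorem T43_eq_filiform : T43 F = filiform 1 0 0 := by
  ext : 1
  simp [T43, filiform]

theorem exists_label_filiform (h2 : (2 : F) ≠ 0) (a b c : F) :
    ∃ l : Label F, (filiform a b c).Isomorphic l.system := by
  have key : ∀ (M : Matrix (Fin 4) (Fin 4) F) (a' b' c' : F), M.det ≠ 0 →
      (∀ x y z, M.mulVec ((filiform a' b' c').bracket x y z) =
        (filiform a b c).bracket (M.mulVec x) (M.mulVec y) (M.mulVec z)) →
      (filiform a b c).Isomorphic (filiform a' b' c') :=
    fun M a' b' c' hM h => (isomorphic_of_matrix M hM h).symm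
  by_cases hb : b = 0
  · subst hb
    by_cases hc : c = 0
    · subst hc
      by_cases ha : a = 0
      · subst ha
        exact ⟨.t2, by rw [Label.system, T42_eq_filiform]; exact .refl _⟩
      · refine ⟨.t3, ?_⟩
        rw [Label.system, T43_eq_filiform]
        refine key !![1, 0, 0, 0; 0, 1, 0, 0; 0, 0, 1, 0; 0, 0, 0, a] _ _ _ ?_ fun x y z => ?_
        · rw [Matrix.det_succ_row_zero]
          simp [Fin.sum_univ_succ, Matrix.det_fin_three, Fin.succAbove, ha]
        · simp only [filiform_bracket]
          ext t
          fin_cases t <;> simp [Matrix.mulVec, dotProduct, Fin.sum_univ_four]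
    · by_cases ha : a = 0
      · subst ha
        refine ⟨.t9, ?_⟩
        rw [Label.system, T49_eq_filiform]
        refine key !![1, 0, 0, 0; 0, 1, 0, 0; 0, 0, 1, 0; 0, 0, 0, c] _ _ _ ?_ fun x y z => ?_
        · rw [Matrix.det_succ_row_zero]
          simp [Fin.sum_univ_succ, Matrix.det_fin_three, Fin.succAbove, hc]
        · simp only [filiform_bracket]
          ext t
          fin_cases t <;> simp [Matrix.mulVec, dotProduct, Fin.sum_univ_four]
      · refine ⟨.t8, ?_⟩
        rw [Label.system, T48_eq_filiform]
        -- Scaling e₂, e₃ by t and e₄ by s requires t²a = s and tc = s, whence t = c/a.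
        refine key !![1, 0, 0, 0; 0, c / a, 0, 0; 0, 0, c / a, 0; 0, 0, 0, c * (c / a)]
          _ _ _ ?_ fun x y z => ?_
        · rw [Matrix.det_succ_row_zero]
          simp [Fin.sum_univ_succ, Matrix.det_fin_three, Fin.succAbove, hc, ha]
        · simp only [filiform_bracket]
          ext t
          fin_cases t <;> simp [Matrix.mulVec, dotProduct, Fin.sum_univ_four] <;> field_simp
  · refine ⟨.t7, ?_⟩
    rw [Label.system, T47_eq_filiform]
    -- The columns are the new basis: e₁ - (c/b)e₂ kills the c-term, e₂ - (a/2b)e₃ kills the a-term,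
    -- and the third column is the resulting [e₁,e₂,e₁].
    refine key !![1, 0, 0, 0; -c / b, 1, 0, 0; 0, -a / (2 * b), 1, 0;
      0, 0, -a * c / b, b] _ _ _ ?_ fun x y z => ?_
    · rw [Matrix.det_succ_row_zero]
      simp [Fin.sum_univ_succ, Matrix.det_fin_three, Fin.succAbove, hb]
    · simp only [filiform_bracket]
      ext t
      fin_cases t <;> simp [Matrix.mulVec, dotProduct, Fin.sum_univ_four, -mul_eq_mul_right_iff] <;>
        field_simp <;> ring

/-- Writing [eᵢ,e₃,eⱼ] as a multiple of e₄, the derivation [e₁,e₂,·] applied to [e₁,e₂,e₁],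
[e₁,e₂,e₂], [e₁,e₂,e₃] and [e₁,e₃,e₁] kills [e₂,e₃,e₁], [e₂,e₃,e₂], [e₂,e₃,e₃] and [e₁,e₃,e₃]. The
cyclic identity then equates [e₁,e₂,e₃] with [e₁,e₃,e₂]. -/
theorem exists_isomorphic_filiform (h2 : (2 : F) ≠ 0) (S : LieTripleSystem F T)
    (e : Module.Basis (Fin 4) F T) (hc : ∀ x y, S.bracket (e 3) x y = 0)
    (hc2 : ∀ x y, S.bracket (e 2) x y ∈ Submodule.span F {e 3})
    (h010 : S.bracket (e 0) (e 1) (e 0) = e 2)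
    (h011 : S.bracket (e 0) (e 1) (e 1) ∈ Submodule.span F {e 3}) :
    ∃ a b c : F, S.Isomorphic (filiform a b c) := by
  have hc' := S.bracket_central_right hc
  have hc'' := S.bracket_central_last hc
  obtain ⟨a, ha⟩ := Submodule.mem_span_singleton.mp h011
  have h2' : ∀ i j, ∃ k : F, S.bracket (e i) (e 2) (e j) = k • e 3 := by
    intro i j
    obtain ⟨k, hk⟩ := Submodule.mem_span_singleton.mp (hc2 (e i) (e j))
    exact ⟨-k, by rw [S.bracket_swap, ← hk, neg_smul]⟩
  choose k hk using h2'
  have h012 : S.bracket (e 0) (e 1) (e 2) = (k 0 1 - k 1 0) • e 3 := by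
    rw [S.bracket_cyclic, hk, hk, sub_smul]
  have h3 := e.ne_zero 3
  have hk' : ∀ i j, S.bracket (e 2) (e i) (e j) = -(k i j • e 3) := fun i j => by
    rw [S.bracket_swap, hk]
  have k10 : k 1 0 = 0 := by
    have := S.derivation (e 0) (e 1) (e 0) (e 1) (e 0)
    rw [h010, ← ha, map_smul, LinearMap.smul_apply, hc', h012, hk'] at this
    refine (smul_eq_zero.mp ?_).resolve_right h3
    rw [eq_comm, ← sub_eq_zero] at this
    rw [← neg_eq_zero, ← this]
    module
  have k11 : k 1 1 = 0 := by
    have := S.derivation (e 0) (e 1) (e 0) (e 1) (e 1)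
    rw [h010, ← ha] at this
    simp only [map_smul, LinearMap.smul_apply, hc', hc'', hk', smul_zero, add_zero] at this
    exact (smul_eq_zero.mp (neg_eq_zero.mp this.symm)).resolve_right h3
  have k12 : k 1 2 = 0 := by
    have := S.derivation (e 0) (e 1) (e 0) (e 1) (e 2)
    rw [h010, ← ha, h012] at this
    simp only [map_smul, LinearMap.smul_apply, hc', hc'', hk', smul_zero, add_zero] at this
    exact (smul_eq_zero.mp (neg_eq_zero.mp this.symm)).resolve_right h3
  have k02 : k 0 2 = 0 := by
    have := S.derivation (e 0) (e 1) (e 0) (e 2) (e 0)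
    rw [h010, h012, S.bracket_self h2] at this
    simp only [map_smul, LinearMap.smul_apply, hc', hc'', hk, smul_zero, add_zero,
      zero_add] at this
    exact (smul_eq_zero.mp this.symm).resolve_right h3
  rw [k10, sub_zero] at h012
  have es : ∀ i, e.equivFun (e i) = Pi.single i 1 := fun i => by
    ext t; simp [Pi.single_apply, eq_comm]
  refine ⟨a, k 0 1, k 0 0, isomorphic_of_basis h2 S _ e hc ?_ ?_⟩
  · intro x y
    rw [filiform_bracket]
    ext t
    fin_cases t <;> simp
  · intro i j l hij hj hl
    rw [filiform_bracket]
    fin_cases i <;> fin_cases j <;> fin_cases l <;>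
      first
        | exact absurd hij (by decide)
        | exact absurd rfl hj
        | exact absurd rfl hl
        | skip
    all_goals
      simp only [Fin.zero_eta, Fin.mk_one, Fin.reduceFinMk, h010, ← ha, h012, hk, k10, k11, k12,
        k02, map_smul, es, zero_smul]
      ext t
      fin_cases t <;> simp

end Filiform

/-! ### Assembling the two cases. -/

section Classification

variable {F T : Type*} [Field F] [AddCommGroup T] [Module F T]

/-- Modulo e₄, z ↦ [e₁,e₂,z] is a functional on ⟨e₁,e₂⟩ with values p, q; its kernel vector pe₂ -
qe₁ serves as the new e₂, and [e₁, pe₂ - qe₁, e₁] as the new e₃. -/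
theorem exists_label_of_adapted (h2 : (2 : F) ≠ 0) (S : LieTripleSystem F T)
    (b : Module.Basis (Fin 4) F T) (hc : ∀ x y, S.bracket (b 3) x y = 0)
    (hc2 : ∀ x y, S.bracket (b 2) x y ∈ Submodule.span F {b 3}) (p p' q q' : F)
    (hp : S.bracket (b 0) (b 1) (b 0) = p • b 2 + p' • b 3)
    (hq : S.bracket (b 0) (b 1) (b 1) = q • b 2 + q' • b 3) (hp0 : p ≠ 0) :
    ∃ l : Label F, S.Isomorphic l.system := by
  have hT : Module.finrank F T = 4 := by simpa using Module.finrank_eq_card_basis b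
  have h1 : S.bracket (b 0) (p • b 1 - q • b 0) (b 0) = (p * p) • b 2 + (p * p') • b 3 := by
    simp only [map_sub, map_smul, LinearMap.sub_apply, LinearMap.smul_apply, hp,
      S.bracket_self h2]
    module
  have hli : LinearIndependent F
      ![b 0, p • b 1 - q • b 0, (p * p) • b 2 + (p * p') • b 3, b 3] := by
    rw [Fintype.linearIndependent_iff]
    intro g hg
    simp only [Fin.sum_univ_four, Matrix.cons_val] at hg
    have hz : ∑ i, ![g 0 - g 1 * q, g 1 * p, g 2 * (p * p), g 2 * (p * p') + g 3] i • b i = 0 := by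
      rw [← hg, Fin.sum_univ_four]
      simp only [Matrix.cons_val]
      module
    have hz' := Fintype.linearIndependent_iff.mp b.linearIndependent _ hz
    have z0 := hz' 0
    have z1 := hz' 1
    have z2 := hz' 2
    have z3 := hz' 3
    simp [hp0] at z0 z1 z2 z3
    intro i
    fin_cases i <;> simp_all
  have hcoe := coe_basisOfLinearIndependentOfCardEqFinrank hli (by simp [hT])
  set e := basisOfLinearIndependentOfCardEqFinrank hli (by simp [hT])
  have e0 : e 0 = b 0 := by rw [hcoe]; rfl
  have e1 : e 1 = p • b 1 - q • b 0 := by rw [hcoe]; rfl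
  have e2 : e 2 = (p * p) • b 2 + (p * p') • b 3 := by rw [hcoe]; rfl
  have e3 : e 3 = b 3 := by rw [hcoe]; rfl
  have m2 : ∀ x y, S.bracket (e 2) x y ∈ Submodule.span F {e 3} := by
    intro x y
    rw [e2, e3]
    simp only [map_add, map_smul, LinearMap.add_apply, LinearMap.smul_apply, hc, smul_zero,
      add_zero]
    exact Submodule.smul_mem _ _ (hc2 x y)
  have m1 : S.bracket (e 0) (e 1) (e 1) ∈ Submodule.span F {e 3} := by
    rw [e0, e1, e3]
    have : S.bracket (b 0) (p • b 1 - q • b 0) (p • b 1 - q • b 0) =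
        (p * (p * q' - q * p')) • b 3 := by
      simp only [map_sub, map_smul, LinearMap.sub_apply, LinearMap.smul_apply, hp, hq,
        S.bracket_self h2]
      module
    rw [this]
    exact Submodule.smul_mem _ _ (Submodule.mem_span_singleton_self _)
  obtain ⟨a, b', c, h⟩ := exists_isomorphic_filiform h2 S e (by rwa [e3]) m2
    (by rw [e0, e1, e2, h1]) m1
  obtain ⟨l, hl⟩ := exists_label_filiform h2 a b' c
  exact ⟨l, h.trans hl⟩

/-- Every four-dimensional nilpotent Lie triple system occurs in the list. -/
theorem IsNilpotent.exists_label [IsAlgClosed F] (h2 : (2 : F) ≠ 0) (h3 : (3 : F) ≠ 0)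
    (S : LieTripleSystem F T) (hT : Module.finrank F T = 4) (hS : S.IsNilpotent) :
    ∃ l : Label F, S.Isomorphic l.system := by
  obtain ⟨b, hc, hc2, hc1⟩ := hS.exists_flag_basis hT
  have hpq : ∀ z, ∃ p p' : F, S.bracket (b 0) (b 1) z = p • b 2 + p' • b 3 := by
    intro z
    obtain ⟨p, p', h⟩ := Submodule.mem_span_pair.mp (hc1 (b 0) z)
    exact ⟨-p, -p', by rw [S.bracket_swap, ← h]; module⟩
  obtain ⟨p, p', hp⟩ := hpq (b 0)
  obtain ⟨q, q', hq⟩ := hpq (b 1)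
  by_cases hp0 : p = 0
  · by_cases hq0 : q = 0
    · subst hp0 hq0
      have hmid : ∀ x y, S.bracket x (b 2) y ∈ Submodule.span F {b 3} := fun x y => by
        rw [S.bracket_swap]
        exact Submodule.neg_mem _ (hc2 x y)
      have hlast : ∀ x y, S.bracket x y (b 2) ∈ Submodule.span F {b 3} := fun x y => by
        rw [S.bracket_cyclic]
        exact Submodule.sub_mem _ (hmid x y) (hmid y x)
      obtain ⟨A, hA, h⟩ := exists_isomorphic_matSys h2 S b hc (by
        have m3 : ∀ r : F, r • b 3 ∈ Submodule.span F {b 3} := fun r =>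
          Submodule.smul_mem _ _ (Submodule.mem_span_singleton_self _)
        intro i j k hij hj hk
        fin_cases i <;> fin_cases j <;> fin_cases k <;>
          first
            | exact absurd hij (by decide)
            | exact absurd rfl hj
            | exact absurd rfl hk
            | exact hmid _ _
            | exact hlast _ _
            | skip
        · simpa [hp] using m3 p'
        · simpa [hq] using m3 q')
      obtain ⟨l, hl⟩ := exists_label_matSys h2 h3 A hA
      exact ⟨l, h.trans hl⟩
    -- Exchanging e₁ and e₂ replaces (p, q) by (-q, -p), so the leading coefficient becomes nonzero.
    · let σ : Equiv.Perm (Fin 4) := Equiv.swap 0 1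
      have s0 : b.reindex σ 0 = b 1 := by simp [σ]
      have s1 : b.reindex σ 1 = b 0 := by simp [σ]
      have s2 : b.reindex σ 2 = b 2 := by
        simp [σ, Equiv.swap_apply_of_ne_of_ne (show (2 : Fin 4) ≠ 0 by decide)
          (show (2 : Fin 4) ≠ 1 by decide)]
      have s3 : b.reindex σ 3 = b 3 := by
        simp [σ, Equiv.swap_apply_of_ne_of_ne (show (3 : Fin 4) ≠ 0 by decide)
          (show (3 : Fin 4) ≠ 1 by decide)]
      refine exists_label_of_adapted h2 S (b.reindex σ) (by rwa [s3]) (by rwa [s2, s3])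
        (-q) (-q') (-p) (-p') ?_ ?_ (neg_ne_zero.mpr hq0)
      · rw [s0, s1, s2, s3, S.bracket_swap, hq]
        module
      · rw [s0, s1, s2, s3, S.bracket_swap, hp]
        module
  · exact exists_label_of_adapted h2 S b hc hc2 p p' q q' hp hq hp0

end Classification

/-! ### Nilpotency of the listed systems. -/

section Nilpotency

variable {F : Type*} [Field F]

/-- The terms 1, 2, 3 of the series lie in ⟨e₃,e₄⟩, ⟨e₄⟩ and 0. -/
theorem isNilpotent_of_coordinates (S : LieTripleSystem F (Fin 4 → F))
    (h0 : ∀ x y z, S.bracket x y z 0 = 0) (h1 : ∀ x y z, S.bracket x y z 1 = 0)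
    (h2 : ∀ w y z, w 0 = 0 → w 1 = 0 → S.bracket w y z 2 = 0)
    (h3 : ∀ w y z, w 0 = 0 → w 1 = 0 → w 2 = 0 → S.bracket w y z = 0) : S.IsNilpotent := by
  have step : ∀ (n : ℕ) (V W : Submodule F (Fin 4 → F)), S.series ⊤ n ≤ V →
      (∀ w ∈ V, ∀ y z, S.bracket w y z ∈ W) → S.series ⊤ (n + 1) ≤ W := by
    intro n V W hV hW
    have hmid : ∀ w ∈ V, ∀ y z, S.bracket y w z ∈ W := fun w hw y z => by
      rw [S.bracket_swap]
      exact W.neg_mem (hW w hw y z)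
    rw [series, sup_le_iff]
    constructor
    · refine Submodule.span_le.mpr ?_
      rintro _ ⟨w, hw, y, -, z, -, rfl⟩
      exact hW w (hV hw) y z
    · refine Submodule.span_le.mpr ?_
      rintro _ ⟨x, -, y, -, w, hw, rfl⟩
      rw [S.bracket_cyclic]
      exact W.sub_mem (hmid w (hV hw) x y) (hmid w (hV hw) y x)
  have s1 := step 0 ⊤ (LinearMap.ker (LinearMap.proj 0) ⊓ LinearMap.ker (LinearMap.proj 1)) le_rfl
    fun w _ y z => ⟨h0 w y z, h1 w y z⟩
  have s2 := step 1 _ (LinearMap.ker (LinearMap.proj 0) ⊓ LinearMap.ker (LinearMap.proj 1) ⊓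
    LinearMap.ker (LinearMap.proj 2)) s1 fun w hw y z =>
      ⟨⟨h0 w y z, h1 w y z⟩, h2 w y z hw.1 hw.2⟩
  have s3 := step 2 _ ⊥ s2 fun w hw y z => (Submodule.mem_bot F).mpr (h3 w y z hw.1.1 hw.1.2 hw.2)
  exact ⟨3, le_bot_iff.mp s3⟩

theorem matSys_isNilpotent (A : Matrix (Fin 3) (Fin 3) F) (hA : A.trace = 0) :
    (matSys A hA).IsNilpotent := by
  apply isNilpotent_of_coordinates
  · simp [matSys_bracket]
  · simp [matSys_bracket]
  · simp [matSys_bracket]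
  · intro w y z w0 w1 w2
    simp [matSys_bracket, w0, w1, w2]

theorem filiform_isNilpotent (a b c : F) : (filiform a b c).IsNilpotent := by
  apply isNilpotent_of_coordinates
  · simp [filiform_bracket]
  · simp [filiform_bracket]
  · intro w y z w0 w1
    simp [filiform_bracket, w0, w1]
  · intro w y z w0 w1 w2
    simp [filiform_bracket, w0, w1, w2]

theorem Label.isNilpotent_system (l : Label F) : l.system.IsNilpotent := by
  cases l <;> rw [Label.system]
  · rw [T41_eq_matSys]; exact matSys_isNilpotent _ _
  · rw [T42_eq_filiform]; exact filiform_isNilpotent _ _ _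
  · rw [T43_eq_filiform]; exact filiform_isNilpotent _ _ _
  · rw [T44_eq_matSys]; exact matSys_isNilpotent _ _
  · rw [T45_eq_matSys]; exact matSys_isNilpotent _ _
  · rw [T46_eq_matSys]; exact matSys_isNilpotent _ _
  · rw [T47_eq_filiform]; exact filiform_isNilpotent _ _ _
  · rw [T48_eq_filiform]; exact filiform_isNilpotent _ _ _
  · rw [T49_eq_filiform]; exact filiform_isNilpotent _ _ _

end Nilpotency

/-! ### Isomorphisms within the one-parameter family. -/

section Family

variable {F : Type*} [Field F]

theorem T46_isomorphic_of_conj {α β : F} (P : Matrix (Fin 3) (Fin 3) F) (hP : P.det ≠ 0) (c : F)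
    (hc : c ≠ 0) (h : !![β, 0, 0; 0, 1, 0; 0, 0, -(β + 1)] * P =
      c • (P * !![α, 0, 0; 0, 1, 0; 0, 0, -(α + 1)])) : (T46 F α).Isomorphic (T46 F β) := by
  rw [T46_eq_matSys, T46_eq_matSys]
  exact matSys_isomorphic_of_conj _ _ P hP c hc h

theorem T46_isomorphic_of_add {α β : F} (h : α + β + 1 = 0) :
    (T46 F α).Isomorphic (T46 F β) := by
  refine T46_isomorphic_of_conj !![0, 0, 1; 0, 1, 0; 1, 0, 0] (by simp [Matrix.det_fin_three]) 1
    one_ne_zero ?_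
  ext i j
  fin_cases i <;> fin_cases j <;> simp [Matrix.mul_apply, Fin.sum_univ_three, -neg_add_rev]
  · linear_combination h
  · linear_combination -h

/-- After clearing denominators the difference is this product; its factors say that β is α, -1-α,
1/α, -(α+1)/α, -1/(α+1) or -α/(α+1), the orbit of α under reordering eigenvalues and rescaling. -/
theorem xi_eq_xi_factor {α β : F} (hα : α ^ 2 + α ≠ 0) (hβ : β ^ 2 + β ≠ 0) (h : xi α = xi β) :
    (α - β) * (α + β + 1) * (α * β - 1) * (α * β + α + 1) * (α * β + β + 1) *
      (α + β + α * β) = 0 := by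
  have e : ∀ γ : F, γ ^ 2 + γ ≠ 0 → γ ^ 2 * (γ + 1) ^ 2 ≠ 0 := fun γ hγ => by
    rw [show γ ^ 2 * (γ + 1) ^ 2 = (γ ^ 2 + γ) ^ 2 by ring]
    exact pow_ne_zero 2 hγ
  rw [xi, xi, div_eq_div_iff (e α hα) (e β hβ)] at h
  linear_combination h

theorem T46_isomorphic_of_xi_eq {α β : F} (hα : α ^ 2 + α ≠ 0) (hβ : β ^ 2 + β ≠ 0)
    (h : xi α = xi β) : (T46 F α).Isomorphic (T46 F β) := by
  have hf := xi_eq_xi_factor hα hβ h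
  have hβ0 : β ≠ 0 := by
    rintro rfl
    simp at hβ
  have hβ1 : -(β + 1) ≠ 0 := by
    intro H
    exact hβ (by linear_combination (-β) * H)
  simp only [mul_eq_zero] at hf
  -- In the conjugating cases P is a permutation matrix, and the scalar is the eigenvalue of the
  -- β-matrix matched with the eigenvalue 1 of the α-matrix.
  rcases hf with ((((hf | hf) | hf) | hf) | hf) | hf
  · rw [sub_eq_zero.mp hf]
    exact .refl _
  · exact T46_isomorphic_of_add hf
  · refine T46_isomorphic_of_conj !![0, 1, 0; 1, 0, 0; 0, 0, 1] (by simp [Matrix.det_fin_three]) β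
      hβ0 ?_
    ext i j
    fin_cases i <;> fin_cases j <;> simp [Matrix.mul_apply, Fin.sum_univ_three, -neg_add_rev]
    · linear_combination -hf
    · linear_combination -hf
  · refine T46_isomorphic_of_conj !![0, 0, 1; 1, 0, 0; 0, 1, 0] (by simp [Matrix.det_fin_three])
      (-(β + 1)) hβ1 ?_
    ext i j
    fin_cases i <;> fin_cases j <;> simp [Matrix.mul_apply, Fin.sum_univ_three, -neg_add_rev]
    · linear_combination -hf
    · linear_combination hf
  · refine T46_isomorphic_of_conj !![0, 1, 0; 0, 0, 1; 1, 0, 0] (by simp [Matrix.det_fin_three]) β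
      hβ0 ?_
    ext i j
    fin_cases i <;> fin_cases j <;> simp [Matrix.mul_apply, Fin.sum_univ_three, -neg_add_rev]
    · linear_combination hf
    · linear_combination -hf
  · refine T46_isomorphic_of_conj !![1, 0, 0; 0, 0, 1; 0, 1, 0] (by simp [Matrix.det_fin_three])
      (-(β + 1)) hβ1 ?_
    ext i j
    fin_cases i <;> fin_cases j <;> simp [Matrix.mul_apply, Fin.sum_univ_three, -neg_add_rev]
    · linear_combination hf
    · linear_combination -hf

/-- Compare determinants and traces of squares under BP = cPA: det A = -(α²+α) and tr A² =
2(α²+α+1). -/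
theorem T46_relations (h2 : (2 : F) ≠ 0) {α β : F} (h : (T46 F α).Isomorphic (T46 F β)) :
    ∃ c : F, c ≠ 0 ∧ β ^ 2 + β = c ^ 3 * (α ^ 2 + α) ∧
      β ^ 2 + β + 1 = c ^ 2 * (α ^ 2 + α + 1) := by
  rw [T46_eq_matSys, T46_eq_matSys] at h
  obtain ⟨P, hP, c, hc, e⟩ := exists_conj_of_matSys_isomorphic h
    (fun H => by simpa using congr_fun₂ H 1 1)
  refine ⟨c, hc, ?_, ?_⟩
  · have e1 := congr_arg Matrix.det e
    rw [Matrix.det_mul, Matrix.det_smul, Matrix.det_mul] at e1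
    refine mul_left_cancel₀ hP ?_
    simp [Matrix.det_fin_three !![_, _, _; _, _, _; _, _, _], -neg_add_rev] at e1
    linear_combination e1
  · set A := !![α, 0, 0; 0, 1, 0; 0, 0, -(α + 1)] with hAdef
    set B := !![β, 0, 0; 0, 1, 0; 0, 0, -(β + 1)] with hBdef
    have hu : IsUnit P.det := isUnit_iff_ne_zero.mpr hP
    have e1 : B * B * P = (c ^ 2) • (P * (A * A)) := by
      rw [mul_assoc, e, Matrix.mul_smul, ← mul_assoc, e, Matrix.smul_mul, smul_smul, mul_assoc,
        sq]
    have e2 : B * B = (c ^ 2) • (P * (A * A) * P⁻¹) := by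
      rw [← Matrix.smul_mul, ← e1, Matrix.mul_nonsing_inv_cancel_right _ _ hu]
    have e3 := congr_arg Matrix.trace e2
    rw [Matrix.trace_smul, Matrix.trace_mul_comm _ P⁻¹, Matrix.nonsing_inv_mul_cancel_left _ _ hu]
      at e3
    simp [hAdef, hBdef, Matrix.trace_fin_three] at e3
    refine mul_left_cancel₀ h2 ?_
    linear_combination e3

/-- A diagonal matrix is not similar to a multiple of a non-diagonalisable one: the columns of P
would be eigenvectors of the T45 matrix, whose second entries all vanish, making P singular. -/
theorem T46_not_isomorphic_T45 (α : F) : ¬ (T46 F α).Isomorphic (T45 F) := by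
  intro h
  rw [T46_eq_matSys, T45_eq_matSys] at h
  obtain ⟨P, hP, c, hc, e⟩ := exists_conj_of_matSys_isomorphic h
    (fun H => by simpa using congr_fun₂ H 1 1)
  have key : ∀ p q m : F, p + q = m * p → q = m * q → q = 0 := by
    intro p q m h1 h2
    by_contra hq
    have : m = 1 := mul_right_cancel₀ hq (by rw [← h2, one_mul])
    subst this
    exact hq (by linear_combination h1)
  have hrow : ∀ j, P 1 j = 0 := by
    intro j
    refine key (P 0 j) (P 1 j) (c * ![α, 1, -(α + 1)] j) ?_ ?_
    · have := congr_fun₂ e 0 j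
      simp [Matrix.mul_apply, Fin.sum_univ_three] at this
      rw [this]
      fin_cases j <;> simp <;> ring
    · have := congr_fun₂ e 1 j
      simp [Matrix.mul_apply, Fin.sum_univ_three] at this
      refine this.trans ?_
      fin_cases j <;> simp <;> ring
  exact hP (Matrix.det_eq_zero_of_row_eq_zero 1 hrow)

end Family

/-! ### Isomorphism invariants. -/

section Invariants

variable {F T T' : Type*} [Field F] [AddCommGroup T] [Module F T] [AddCommGroup T'] [Module F T']

/-- All products vanish. -/
def IsAbelian (S : LieTripleSystem F T) : Prop := ∀ x y z, S.bracket x y z = 0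

/-- All products are central. -/
def IsTwoStep (S : LieTripleSystem F T) : Prop :=
  ∀ x y z u v, S.bracket (S.bracket x y z) u v = 0

/-- All products lie on one line. -/
def HasRankLEOne (S : LieTripleSystem F T) : Prop :=
  ∃ w, ∀ x y z, ∃ k : F, S.bracket x y z = k • w

/-- Every derived element `w` gives a symmetric map `(x, y) ↦ [x, w, y]`. -/
def IsDerivedSymm (S : LieTripleSystem F T) : Prop :=
  ∀ x y u v w, S.bracket x (S.bracket u v w) y = S.bracket y (S.bracket u v w) x

/-- `[x, y, y] = 0` whenever `[y, w, ·] = 0` for all products `w`. -/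
def IsDerivedCentralizerIsotropic (S : LieTripleSystem F T) : Prop :=
  ∀ y, (∀ u v w z, S.bracket y (S.bracket u v w) z = 0) → ∀ x, S.bracket x y y = 0

/-- The system is given by a matrix satisfying `A ^ n = 0`. -/
def IsNilpotentMatSys (n : ℕ) (S : LieTripleSystem F T) : Prop :=
  ∃ (A : Matrix (Fin 3) (Fin 3) F) (hA : A.trace = 0), A ^ n = 0 ∧ S.Isomorphic (matSys A hA)

theorem IsAbelian.of_isomorphic {S : LieTripleSystem F T} {S' : LieTripleSystem F T'}
    (h : S.Isomorphic S') (hS : S.IsAbelian) : S'.IsAbelian := by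
  obtain ⟨φ, hφ⟩ := h.symm
  intro x y z
  apply φ.injective
  rw [hφ, hS, map_zero]

theorem IsTwoStep.of_isomorphic {S : LieTripleSystem F T} {S' : LieTripleSystem F T'}
    (h : S.Isomorphic S') (hS : S.IsTwoStep) : S'.IsTwoStep := by
  obtain ⟨φ, hφ⟩ := h.symm
  intro x y z u v
  apply φ.injective
  rw [hφ, hφ, hS, map_zero]

theorem HasRankLEOne.of_isomorphic {S : LieTripleSystem F T} {S' : LieTripleSystem F T'}
    (h : S.Isomorphic S') (hS : S.HasRankLEOne) : S'.HasRankLEOne := by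
  obtain ⟨φ, hφ⟩ := h.symm
  obtain ⟨w, hw⟩ := hS
  refine ⟨φ.symm w, fun x y z => ?_⟩
  obtain ⟨k, hk⟩ := hw (φ x) (φ y) (φ z)
  refine ⟨k, ?_⟩
  apply φ.injective
  rw [hφ, hk, map_smul, LinearEquiv.apply_symm_apply]

theorem IsDerivedSymm.of_isomorphic {S : LieTripleSystem F T} {S' : LieTripleSystem F T'}
    (h : S.Isomorphic S') (hS : S.IsDerivedSymm) : S'.IsDerivedSymm := by
  obtain ⟨φ, hφ⟩ := h.symm
  intro x y u v w
  apply φ.injective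
  simp only [hφ]
  exact hS _ _ _ _ _

theorem IsDerivedCentralizerIsotropic.of_isomorphic {S : LieTripleSystem F T}
    {S' : LieTripleSystem F T'} (h : S.Isomorphic S') (hS : S.IsDerivedCentralizerIsotropic) :
    S'.IsDerivedCentralizerIsotropic := by
  obtain ⟨φ, hφ⟩ := h.symm
  intro y hy x
  apply φ.injective
  rw [hφ, map_zero]
  refine hS (φ y) (fun u v w z => ?_) (φ x)
  have := congr_arg φ (hy (φ.symm u) (φ.symm v) (φ.symm w) (φ.symm z))
  simpa [hφ] using this

theorem IsNilpotentMatSys.of_isomorphic {n : ℕ} {S : LieTripleSystem F T}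
    {S' : LieTripleSystem F T'} (h : S.Isomorphic S') (hS : S.IsNilpotentMatSys n) :
    S'.IsNilpotentMatSys n := by
  obtain ⟨A, hA, hn, hi⟩ := hS
  exact ⟨A, hA, hn, h.symm.trans hi⟩

end Invariants

/-! ### Values of the invariants and separation of the list. -/

section Distinguish

variable {F : Type*} [Field F]

theorem matSys_isTwoStep (A : Matrix (Fin 3) (Fin 3) F) (hA : A.trace = 0) :
    (matSys A hA).IsTwoStep := by
  intro x y z u v
  simp [matSys_bracket]

theorem matSys_hasRankLEOne (A : Matrix (Fin 3) (Fin 3) F) (hA : A.trace = 0) :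
    (matSys A hA).HasRankLEOne :=
  ⟨Pi.single 3 1, fun x y z => ⟨_, matSys_bracket A hA x y z⟩⟩

theorem matSys_isDerivedSymm (A : Matrix (Fin 3) (Fin 3) F) (hA : A.trace = 0) :
    (matSys A hA).IsDerivedSymm := by
  intro x y u v w
  simp [matSys_bracket]

theorem matSys_isAbelian_iff (A : Matrix (Fin 3) (Fin 3) F) (hA : A.trace = 0) :
    (matSys A hA).IsAbelian ↔ A = 0 := by
  constructor
  · intro h
    ext i j
    have := congr_fun (h (Pi.single (![1, 2, 0] i) 1) (Pi.single (![2, 0, 1] i) 1)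
      (Pi.single j.castSucc 1)) 3
    rw [matSys_bracket] at this
    fin_cases i <;> fin_cases j <;> simpa using this
  · rintro rfl x y z
    simp [matSys_bracket]

/-- BP = cPA implies BⁿP = cⁿPAⁿ, so vanishing of the n-th power does not depend on the representing
matrix. -/
theorem matSys_isNilpotentMatSys_iff (n : ℕ) (A : Matrix (Fin 3) (Fin 3) F) (hA : A.trace = 0)
    (hA0 : A ≠ 0) : (matSys A hA).IsNilpotentMatSys n ↔ A ^ n = 0 := by
  constructor
  · rintro ⟨B, hB, hn, h⟩
    obtain ⟨P, hP, c, hc, e⟩ := exists_conj_of_matSys_isomorphic h hA0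
    have e' : ∀ m, B ^ m * P = c ^ m • (P * A ^ m) := by
      intro m
      induction m with
      | zero => simp
      | succ m ih =>
        rw [pow_succ', mul_assoc, ih, Matrix.mul_smul, ← mul_assoc, e, Matrix.smul_mul, smul_smul,
          mul_assoc, ← pow_succ', ← pow_succ]
    have h0 := e' n
    rw [hn, zero_mul, eq_comm, smul_eq_zero] at h0
    have h1 := h0.resolve_left (pow_ne_zero n hc)
    rw [← Matrix.nonsing_inv_mul_cancel_left P (A ^ n) (isUnit_iff_ne_zero.mpr hP), h1, mul_zero]
  · exact fun h => ⟨A, hA, h, .refl _⟩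

theorem filiform_isTwoStep_iff (a b c : F) :
    (filiform a b c).IsTwoStep ↔ b = 0 ∧ c = 0 := by
  constructor
  · intro h
    have h1 := congr_fun (h (Pi.single 0 1) (Pi.single 1 1) (Pi.single 0 1) (Pi.single 0 1)
      (Pi.single 1 1)) 3
    have h2 := congr_fun (h (Pi.single 0 1) (Pi.single 1 1) (Pi.single 0 1) (Pi.single 0 1)
      (Pi.single 0 1)) 3
    simp [filiform_bracket] at h1 h2
    exact ⟨h1, h2⟩
  · rintro ⟨rfl, rfl⟩ x y z u v
    ext t
    fin_cases t <;> simp [filiform_bracket]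

theorem filiform_not_isAbelian (a b c : F) : ¬ (filiform a b c).IsAbelian := by
  intro h
  simpa [filiform_bracket] using congr_fun (h (Pi.single 0 1) (Pi.single 1 1) (Pi.single 0 1)) 2

theorem filiform_hasRankLEOne_iff (a b c : F) :
    (filiform a b c).HasRankLEOne ↔ a = 0 ∧ b = 0 ∧ c = 0 := by
  constructor
  · rintro ⟨w, hw⟩
    obtain ⟨k, hk⟩ := hw (Pi.single 0 1) (Pi.single 1 1) (Pi.single 0 1)
    have hw2 : w 2 ≠ 0 := by
      intro H
      simpa [filiform_bracket, H] using congr_fun hk 2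
    have key : ∀ x y z, (filiform a b c).bracket x y z 2 = 0 →
        (filiform a b c).bracket x y z 3 = 0 := by
      intro x y z h
      obtain ⟨k, hk⟩ := hw x y z
      rw [hk] at h ⊢
      have : k = 0 := (mul_eq_zero.mp h).resolve_right hw2
      simp [this]
    have h1 := key (Pi.single 0 1) (Pi.single 1 1) (Pi.single 1 1)
    have h2 := key (Pi.single 0 1) (Pi.single 2 1) (Pi.single 1 1)
    have h3 := key (Pi.single 0 1) (Pi.single 2 1) (Pi.single 0 1)
    simp [filiform_bracket] at h1 h2 h3
    exact ⟨h1, h2, h3⟩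
  · rintro ⟨rfl, rfl, rfl⟩
    refine ⟨Pi.single 2 1, fun x y z => ⟨(x 0 * y 1 - x 1 * y 0) * z 0, ?_⟩⟩
    ext t
    fin_cases t <;> simp [filiform_bracket]

/-- Products lie in ⟨e₃,e₄⟩ and [x,e₃,y] = x₁(by₂ + cy₁)e₄, which is symmetric exactly when b = 0.
-/
theorem filiform_isDerivedSymm_iff (a b c : F) : (filiform a b c).IsDerivedSymm ↔ b = 0 := by
  constructor
  · intro h
    simpa [filiform_bracket] using congr_fun (h (Pi.single 0 1) (Pi.single 1 1) (Pi.single 0 1)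
      (Pi.single 1 1) (Pi.single 0 1)) 3
  · rintro rfl x y u v w
    ext t
    fin_cases t <;> simp [filiform_bracket, -mul_eq_mul_left_iff]
    ring

/-- Annihilating e₃ forces the e₁-coordinate of y to be zero, and with a = b = 0 every term of
[x,y,y] contains it. For a = 1 the vector y = e₂ is a counterexample, which separates T48 from T49.
-/
theorem filiform_isDerivedCentralizerIsotropic :
    (filiform (0 : F) 0 1).IsDerivedCentralizerIsotropic := by
  intro y hy x
  have h0 := congr_fun (hy (Pi.single 0 1) (Pi.single 1 1) (Pi.single 0 1) (Pi.single 0 1)) 3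
  simp [filiform_bracket] at h0
  ext t
  fin_cases t <;> simp [filiform_bracket, h0]

theorem filiform_not_isDerivedCentralizerIsotropic :
    ¬ (filiform (1 : F) 0 1).IsDerivedCentralizerIsotropic := by
  intro h
  have h1 := h (Pi.single 1 1) (fun u v w z => by
    ext t
    fin_cases t <;> simp [filiform_bracket]) (Pi.single 0 1)
  simpa [filiform_bracket] using congr_fun h1 3

/-- The position of a name in the list. -/
def Label.kind : Label F → Fin 9
  | .t1 => 0
  | .t2 => 1
  | .t3 => 2
  | .t4 => 3
  | .t5 => 4
  | .t6 _ => 5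
  | .t7 => 6
  | .t8 => 7
  | .t9 => 8

theorem Label.isAbelian_iff (l : Label F) : l.system.IsAbelian ↔ l.kind = 0 := by
  cases l <;> rw [Label.system, Label.kind]
  · rw [T41_eq_matSys, matSys_isAbelian_iff]; simp
  · rw [T42_eq_filiform]; simpa using filiform_not_isAbelian _ _ _
  · rw [T43_eq_filiform]; simpa using filiform_not_isAbelian _ _ _
  · rw [T44_eq_matSys, matSys_isAbelian_iff]
    refine iff_of_false (fun H => one_ne_zero (congr_fun₂ H 0 1)) (by decide)
  · rw [T45_eq_matSys, matSys_isAbelian_iff]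
    refine iff_of_false (fun H => one_ne_zero (congr_fun₂ H 1 1)) (by decide)
  · rw [T46_eq_matSys, matSys_isAbelian_iff]
    refine iff_of_false (fun H => one_ne_zero (congr_fun₂ H 1 1)) (by decide)
  · rw [T47_eq_filiform]; simpa using filiform_not_isAbelian _ _ _
  · rw [T48_eq_filiform]; simpa using filiform_not_isAbelian _ _ _
  · rw [T49_eq_filiform]; simpa using filiform_not_isAbelian _ _ _

theorem Label.isTwoStep_iff (l : Label F) : l.system.IsTwoStep ↔ l.kind ≤ 5 := by
  cases l <;> rw [Label.system, Label.kind]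
  · rw [T41_eq_matSys]; simpa using matSys_isTwoStep _ _
  · rw [T42_eq_filiform, filiform_isTwoStep_iff]; simp
  · rw [T43_eq_filiform, filiform_isTwoStep_iff]; simp
  · rw [T44_eq_matSys]; simpa using matSys_isTwoStep _ _
  · rw [T45_eq_matSys]; simpa using matSys_isTwoStep _ _
  · rw [T46_eq_matSys]; simpa using matSys_isTwoStep _ _
  · rw [T47_eq_filiform, filiform_isTwoStep_iff]; simp
  · rw [T48_eq_filiform, filiform_isTwoStep_iff]; simp
  · rw [T49_eq_filiform, filiform_isTwoStep_iff]; simp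

theorem Label.hasRankLEOne_iff (l : Label F) :
    l.system.HasRankLEOne ↔ l.kind ≠ 2 ∧ l.kind ≤ 5 := by
  cases l <;> rw [Label.system, Label.kind]
  · rw [T41_eq_matSys]; simpa using matSys_hasRankLEOne _ _
  · rw [T42_eq_filiform, filiform_hasRankLEOne_iff]; simp
  · rw [T43_eq_filiform, filiform_hasRankLEOne_iff]; simp
  · rw [T44_eq_matSys]; simpa using matSys_hasRankLEOne _ _
  · rw [T45_eq_matSys]; simpa using matSys_hasRankLEOne _ _
  · rw [T46_eq_matSys]; simpa using matSys_hasRankLEOne _ _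
  · rw [T47_eq_filiform, filiform_hasRankLEOne_iff]; simp
  · rw [T48_eq_filiform, filiform_hasRankLEOne_iff]; simp
  · rw [T49_eq_filiform, filiform_hasRankLEOne_iff]; simp

theorem Label.isDerivedSymm_iff (l : Label F) : l.system.IsDerivedSymm ↔ l.kind ≠ 6 := by
  cases l <;> rw [Label.system, Label.kind]
  · rw [T41_eq_matSys]; simpa using matSys_isDerivedSymm _ _
  · rw [T42_eq_filiform, filiform_isDerivedSymm_iff]; simp
  · rw [T43_eq_filiform, filiform_isDerivedSymm_iff]; simp
  · rw [T44_eq_matSys]; simpa using matSys_isDerivedSymm _ _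
  · rw [T45_eq_matSys]; simpa using matSys_isDerivedSymm _ _
  · rw [T46_eq_matSys]; simpa using matSys_isDerivedSymm _ _
  · rw [T47_eq_filiform, filiform_isDerivedSymm_iff]; simp
  · rw [T48_eq_filiform, filiform_isDerivedSymm_iff]; simp
  · rw [T49_eq_filiform, filiform_isDerivedSymm_iff]; simp

theorem T42_isNilpotentMatSys {n : ℕ} (hn : 2 ≤ n) : (T42 F).IsNilpotentMatSys n := by
  refine ⟨_, _, ?_, T42_isomorphic_matSys⟩
  refine pow_eq_zero_of_le hn ?_
  ext i j
  fin_cases i <;> fin_cases j <;> simp [sq, Matrix.mul_apply, Fin.sum_univ_three]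

theorem T44_isNilpotentMatSys_iff (n : ℕ) :
    (T44 F).IsNilpotentMatSys n ↔
      (!![0, 1, 0; 0, 0, 1; 0, 0, 0] : Matrix (Fin 3) (Fin 3) F) ^ n = 0 := by
  rw [T44_eq_matSys, matSys_isNilpotentMatSys_iff]
  exact fun H => one_ne_zero (congr_fun₂ H 0 1)

theorem T44_not_isNilpotentMatSys_two : ¬ (T44 F).IsNilpotentMatSys 2 := by
  rw [T44_isNilpotentMatSys_iff]
  intro H
  simpa [sq, Matrix.mul_apply, Fin.sum_univ_three] using congr_fun₂ H 0 2

theorem T44_isNilpotentMatSys_three : (T44 F).IsNilpotentMatSys 3 := by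
  rw [T44_isNilpotentMatSys_iff]
  ext i j
  fin_cases i <;> fin_cases j <;> simp [pow_succ, Matrix.mul_apply, Fin.sum_univ_three]

theorem matSys_not_isNilpotentMatSys {A : Matrix (Fin 3) (Fin 3) F} (hA : A.trace = 0)
    {v : Fin 3 → F} (hv : v ≠ 0) (hAv : A.mulVec v = v) (n : ℕ) :
    ¬ (matSys A hA).IsNilpotentMatSys n := by
  have hA0 : A ≠ 0 := by
    rintro rfl
    exact hv (by simpa using hAv.symm)
  rw [matSys_isNilpotentMatSys_iff n A hA hA0]
  intro H
  have : ∀ m, (A ^ m).mulVec v = v := by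
    intro m
    induction m with
    | zero => simp
    | succ m ih => rw [pow_succ, ← Matrix.mulVec_mulVec, hAv, ih]
  have h := this n
  rw [H, Matrix.zero_mulVec] at h
  exact hv h.symm

theorem T45_not_isNilpotentMatSys (n : ℕ) : ¬ (T45 F).IsNilpotentMatSys n := by
  rw [T45_eq_matSys]
  refine matSys_not_isNilpotentMatSys _ (v := Pi.single 0 1) (by simp) ?_ n
  ext i
  fin_cases i <;> simp

theorem T46_not_isNilpotentMatSys (a : F) (n : ℕ) : ¬ (T46 F a).IsNilpotentMatSys n := by
  rw [T46_eq_matSys]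
  refine matSys_not_isNilpotentMatSys _ (v := Pi.single 1 1) (by simp) ?_ n
  ext i
  fin_cases i <;> simp

theorem T41_isNilpotentMatSys {n : ℕ} (hn : n ≠ 0) : (T41 F).IsNilpotentMatSys n :=
  ⟨0, by simp, zero_pow hn, by rw [T41_eq_matSys]; exact .refl _⟩

theorem Label.isNilpotentMatSys_two_iff {l : Label F} (hl : l.kind ≠ 2 ∧ l.kind ≤ 5) :
    l.system.IsNilpotentMatSys 2 ↔ l.kind ≤ 1 := by
  cases l
  case t1 => exact iff_of_true (T41_isNilpotentMatSys (by decide)) (by simp [Label.kind])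
  case t2 => exact iff_of_true (T42_isNilpotentMatSys le_rfl) (by simp [Label.kind])
  case t4 => exact iff_of_false T44_not_isNilpotentMatSys_two (by simp [Label.kind])
  case t5 => exact iff_of_false (T45_not_isNilpotentMatSys 2) (by simp [Label.kind])
  case t6 a => exact iff_of_false (T46_not_isNilpotentMatSys a 2) (by simp [Label.kind])
  all_goals exact absurd hl (by simp [Label.kind])

theorem Label.isNilpotentMatSys_three_iff {l : Label F} (hl : l.kind ≠ 2 ∧ l.kind ≤ 5) :
    l.system.IsNilpotentMatSys 3 ↔ l.kind ≤ 3 := by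
  cases l
  case t1 => exact iff_of_true (T41_isNilpotentMatSys (by decide)) (by simp [Label.kind])
  case t2 => exact iff_of_true (T42_isNilpotentMatSys (by decide)) (by simp [Label.kind])
  case t4 => exact iff_of_true T44_isNilpotentMatSys_three (by simp [Label.kind])
  case t5 => exact iff_of_false (T45_not_isNilpotentMatSys 3) (by simp [Label.kind])
  case t6 a => exact iff_of_false (T46_not_isNilpotentMatSys a 3) (by simp [Label.kind])
  all_goals exact absurd hl (by simp [Label.kind])

theorem Label.isomorphic_T45_iff {l : Label F} (hl : l.kind = 4 ∨ l.kind = 5) :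
    l.system.Isomorphic (T45 F) ↔ l.kind = 4 := by
  cases l
  case t5 => exact iff_of_true (.refl _) (by simp [Label.kind])
  case t6 a => exact iff_of_false (T46_not_isomorphic_T45 a) (by simp [Label.kind])
  all_goals exact absurd hl (by simp [Label.kind])

theorem Label.isDerivedCentralizerIsotropic_iff {l : Label F} (hl : 7 ≤ l.kind) :
    l.system.IsDerivedCentralizerIsotropic ↔ l.kind = 8 := by
  cases l
  case t8 =>
    rw [Label.system, T48_eq_filiform]
    exact iff_of_false filiform_not_isDerivedCentralizerIsotropic (by simp [Label.kind])
  case t9 =>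
    rw [Label.system, T49_eq_filiform]
    exact iff_of_true filiform_isDerivedCentralizerIsotropic (by simp [Label.kind])
  all_goals exact absurd hl (by simp [Label.kind])

/-- Two-step nilpotency cuts off T47, T48, T49; derived symmetry isolates T47, and the centralizer
condition splits T48 from T49. Below, commutativity isolates T41 and rank isolates T43; A² = 0 and
A³ = 0 then separate T42, T44 and the pair T45, T46, which diagonalisability splits. -/
theorem Label.kind_eq_of_isomorphic {l l' : Label F} (h : l.system.Isomorphic l'.system) :
    l.kind = l'.kind := by
  have i1 : l.kind = 0 ↔ l'.kind = 0 := by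
    rw [← l.isAbelian_iff, ← l'.isAbelian_iff]
    exact ⟨.of_isomorphic h, .of_isomorphic h.symm⟩
  have i2 : l.kind ≤ 5 ↔ l'.kind ≤ 5 := by
    rw [← l.isTwoStep_iff, ← l'.isTwoStep_iff]
    exact ⟨.of_isomorphic h, .of_isomorphic h.symm⟩
  have i3 : (l.kind ≠ 2 ∧ l.kind ≤ 5) ↔ (l'.kind ≠ 2 ∧ l'.kind ≤ 5) := by
    rw [← l.hasRankLEOne_iff, ← l'.hasRankLEOne_iff]
    exact ⟨.of_isomorphic h, .of_isomorphic h.symm⟩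
  have i4 : l.kind ≠ 6 ↔ l'.kind ≠ 6 := by
    rw [← l.isDerivedSymm_iff, ← l'.isDerivedSymm_iff]
    exact ⟨.of_isomorphic h, .of_isomorphic h.symm⟩
  have i5 : (l.kind ≠ 2 ∧ l.kind ≤ 5) → (l'.kind ≠ 2 ∧ l'.kind ≤ 5) →
      (l.kind ≤ 1 ↔ l'.kind ≤ 1) := fun hl hl' => by
    rw [← isNilpotentMatSys_two_iff hl, ← isNilpotentMatSys_two_iff hl']
    exact ⟨.of_isomorphic h, .of_isomorphic h.symm⟩
  have i6 : (l.kind ≠ 2 ∧ l.kind ≤ 5) → (l'.kind ≠ 2 ∧ l'.kind ≤ 5) →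
      (l.kind ≤ 3 ↔ l'.kind ≤ 3) := fun hl hl' => by
    rw [← isNilpotentMatSys_three_iff hl, ← isNilpotentMatSys_three_iff hl']
    exact ⟨.of_isomorphic h, .of_isomorphic h.symm⟩
  have i7 : (l.kind = 4 ∨ l.kind = 5) → (l'.kind = 4 ∨ l'.kind = 5) →
      (l.kind = 4 ↔ l'.kind = 4) := fun hl hl' => by
    rw [← isomorphic_T45_iff hl, ← isomorphic_T45_iff hl']
    exact ⟨h.symm.trans, h.trans⟩
  have i8 : 7 ≤ l.kind → 7 ≤ l'.kind → (l.kind = 8 ↔ l'.kind = 8) := fun hl hl' => by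
    rw [← isDerivedCentralizerIsotropic_iff hl, ← isDerivedCentralizerIsotropic_iff hl']
    exact ⟨.of_isomorphic h, .of_isomorphic h.symm⟩
  generalize l.kind = k at *
  generalize l'.kind = k' at *
  clear h
  omega

theorem T46_isomorphic_cases (h2 : (2 : F) ≠ 0) {α β : F} (h : (T46 F α).Isomorphic (T46 F β)) :
    α = β ∨ (α = 0 ∧ β = -1) ∨ (α = -1 ∧ β = 0) ∨
      (α ^ 2 + α ≠ 0 ∧ β ^ 2 + β ≠ 0 ∧ xi α = xi β) := by
  obtain ⟨c, hc, e1, e2⟩ := T46_relations h2 h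
  have root : ∀ γ : F, γ ^ 2 + γ = 0 → γ = 0 ∨ γ = -1 := by
    intro γ hγ
    have : γ * (γ + 1) = 0 := by linear_combination hγ
    exact (mul_eq_zero.mp this).imp_right eq_neg_of_add_eq_zero_left
  -- Vanishing determinant is preserved, leaving the parameters 0 and -1; otherwise the factors c⁶
  -- cancel in ξ.
  by_cases hα : α ^ 2 + α = 0
  · have hβ : β ^ 2 + β = 0 := by rw [e1, hα, mul_zero]
    rcases root α hα with rfl | rfl <;> rcases root β hβ with rfl | rfl <;> simp
  · have hβ : β ^ 2 + β ≠ 0 := by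
      rw [e1]
      exact mul_ne_zero (pow_ne_zero 3 hc) hα
    refine Or.inr (Or.inr (Or.inr ⟨hα, hβ, ?_⟩))
    have hxi : ∀ γ : F, xi γ = (γ ^ 2 + γ + 1) ^ 3 / (γ ^ 2 + γ) ^ 2 := fun γ => by
      rw [xi]
      congr 1
      ring
    rw [hxi, hxi, e2, e1, div_eq_div_iff (pow_ne_zero 2 hα)
      (pow_ne_zero 2 (mul_ne_zero (pow_ne_zero 3 hc) hα))]
    ring

theorem Label.isomorphic_iff (h2 : (2 : F) ≠ 0) (l l' : Label F) :
    l.system.Isomorphic l'.system ↔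
      (l = l' ∨ (l = .t6 0 ∧ l' = .t6 (-1)) ∨ (l = .t6 (-1) ∧ l' = .t6 0) ∨
        ∃ α β : F, α ^ 2 + α ≠ 0 ∧ β ^ 2 + β ≠ 0 ∧ xi α = xi β ∧ l = .t6 α ∧ l' = .t6 β) := by
  constructor
  · intro h
    have hk := Label.kind_eq_of_isomorphic h
    by_cases h6 : l.kind = 5
    swap
    · left
      cases l <;> cases l' <;>
        first | rfl | exact absurd rfl h6 | exact absurd hk (by simp [Label.kind])
    obtain ⟨α, rfl⟩ : ∃ α, l = .t6 α := by
      cases l <;> first | exact ⟨_, rfl⟩ | exact absurd h6 (by simp [Label.kind])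
    obtain ⟨β, rfl⟩ : ∃ β, l' = .t6 β := by
      rw [h6] at hk
      cases l' <;> first | exact ⟨_, rfl⟩ | exact absurd hk (by simp [Label.kind])
    rcases T46_isomorphic_cases h2 h with rfl | ⟨rfl, rfl⟩ | ⟨rfl, rfl⟩ | ⟨hα, hβ, hx⟩
    · exact Or.inl rfl
    · exact Or.inr (Or.inl ⟨rfl, rfl⟩)
    · exact Or.inr (Or.inr (Or.inl ⟨rfl, rfl⟩))
    · exact Or.inr (Or.inr (Or.inr ⟨α, β, hα, hβ, hx, rfl, rfl⟩))
  · rintro (rfl | ⟨rfl, rfl⟩ | ⟨rfl, rfl⟩ | ⟨α, β, hα, hβ, hx, rfl, rfl⟩)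
    · exact .refl _
    · exact T46_isomorphic_of_add (by ring)
    · exact T46_isomorphic_of_add (by ring)
    · exact T46_isomorphic_of_xi_eq hα hβ hx

end Distinguish

end LieTripleSystem

theorem mainTheorem4 (F : Type*) [Field F] [IsAlgClosed F]
    (hF2 : ringChar F ≠ 2) (hF3 : ringChar F ≠ 3) :
    -- every four-dimensional nilpotent Lie triple system occurs in the list
    (∀ (T : Type*) [AddCommGroup T] [Module F T] (S : LieTripleSystem F T),
      Module.finrank F T = 4 → S.IsNilpotent →
        ∃ l : LieTripleSystem.Label F, S.Isomorphic l.system) ∧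
    -- every member of the list is nilpotent
    (∀ l : LieTripleSystem.Label F, l.system.IsNilpotent) ∧
    -- the isomorphisms between members of the list
    (∀ l l' : LieTripleSystem.Label F, l.system.Isomorphic l'.system ↔
      (l = l' ∨
        (l = .t6 0 ∧ l' = .t6 (-1)) ∨
        (l = .t6 (-1) ∧ l' = .t6 0) ∨
        ∃ α β : F, α ^ 2 + α ≠ 0 ∧ β ^ 2 + β ≠ 0 ∧
          LieTripleSystem.xi α = LieTripleSystem.xi β ∧ l = .t6 α ∧ l' = .t6 β)) := by
  have h2 : (2 : F) ≠ 0 := Ring.two_ne_zero hF2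
  have h3 : (3 : F) ≠ 0 := by
    intro h
    have hd := ringChar.dvd (R := F) (x := 3) (by exact_mod_cast h)
    rcases (Nat.dvd_prime Nat.prime_three).mp hd with h1 | h1
    · exact CharP.ringChar_ne_one h1
    · exact hF3 h1
  exact ⟨fun T _ _ S hT hS => hS.exists_label h2 h3 S hT, fun l => l.isNilpotent_system,
    LieTripleSystem.Label.isomorphic_iff h2⟩
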